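/- Let $n\ge 2$, identify $\mathbb R^n=\mathbb R^{n-1}\times\mathbb R$, and let $\mathbb H=\{(y,t): y\in\mathbb R^{n-1},\ t>0\}$ be the open upper half-space. Let $S\subseteq\mathbb R^{n-1}$ be a non-empty subset, $p_0\in S$, and $S^\times:=S\setminus\{p_0\}$ with the subspace topology. For $p\in S$ let $\mathcal R_p$ be the set of rays $\{(p+tv,t): t>0\}$, $v\in\mathbb R^{n-1}$, in $\mathbb H$ based at $p$, topologized by the slope $v$ (equivalently, as a subspace of the projective space of lines through $p$). The bordered Prüfer manifold is the set $\mathbb H\sqcup\coprod_{p\in S}\mathcal R_p$, topologized as follows: a set $U$ is open iff $U\cap\mathbb H$ is open in $\mathbb H$, each $U\cap\mathcal R_p$ is open in $\mathcal R_p$, and for every ray $r\in U\cap\mathcal R_p$, every net $(x_\lambda)$ in $\mathbb H$ such that $x_\lambda\to p$ in $\mathbb R^n$ and the rays from $p$ through $x_\lambda$ converge to $r$ in $\mathcal R_p$ is eventually in $U$. The Prüfer $n$-manifold $PF=PF^n_S$ is obtained by gluing two copies of the bordered Prüfer manifold along $\coprod_{p\in S}\mathcal R_p$. For $p\in S^\times$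 let $\alpha_{p_0,p}$ be the loop in $PF$, based at the vertical ray at $p_0$, which first runs along the semicircle with diameter $[p_0,p]$ orthogonal to the boundary, in the first copy, from the vertical ray at $p_0$ to the vertical ray at $p$, and then returns along the mirror-image semicircle in the second copy. Let $\pi^1(PF)=[PF,\mathbb S^1]$ be the group of free homotopy classes of continuous maps $PF\to\mathbb S^1$ (with multiplication induced from that of $\mathbb S^1$), and let $$\mathrm{comp}:\pi^1(PF)\to\mathrm{Hom}(\pi_1(PF),\mathbb Z),\qquad [f]\mapsto \bigl(f_*:\pi_1(PF)\to\pi_1(\mathbb S^1)\cong\mathbb Z\bigr)$$ be the comparison morphism, where $\pi_1(PF)$ is based at the vertical ray at $p_0$. Then: 1. $\pi_1(PF)$ is free on the classes of the loops $\alpha_{p_0,p}$, $p\in S^\times$; consequently $\varphi\mapsto\bigl(p\mapsto\varphi([\alpha_{p_0,p}])\bigr)$ is an isomorphism from $\mathrm{Hom}(\pi_1(PF),\mathbb Z)$ onto the additive group of all functions $S^\times\to\mathbb Z$. 2. $\mathrm{comp}$ is an injective group homomorphism. 3. Under the isomorphism in 1, the image of $\mathrm{comp}$ is exactly the additive group of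 Baire-1 functions $S^\times\to\mathbb Z$, i.e. of those functions for which the preimage of every open (equivalently, every) subset of $\mathbb Z$ is a countable union of closed subsets of $S^\times$. -/

import Mathlib

open Set Filter Topology
open scoped unitInterval

noncomputable section

namespace Prufer

/-! ### Degree of loops in the circle -/

theorem exists_circle_lift (γ : C(I, Circle)) : ∃ θ : C(I, ℝ), ∀ t, Circle.exp (θ t) = γ t := by
  obtain ⟨e, he⟩ := Circle.exp_surjective (γ 0)
  obtain ⟨θ, h, -⟩ := Circle.isCoveringMap_exp.exists_path_lifts γ e he.symm
  exact ⟨θ, fun t => congrFun h t⟩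

/-- The winding number of a map `γ : [0,1] → 𝕊¹` (meant for loops, `γ 0 = γ 1`): lift `γ` through
`θ ↦ exp (iθ)` and divide the increment of the lift by `2π`. For loops the quotient is an integer
and does not depend on the lift, see `windingNumber_spec`. -/
def windingNumber (γ : C(I, Circle)) : ℤ :=
  round (((exists_circle_lift γ).choose 1 - (exists_circle_lift γ).choose 0) / (2 * Real.pi))

theorem lift_eq_add (θ θ' : C(I, ℝ)) (h : ∀ t, Circle.exp (θ t) = Circle.exp (θ' t)) :
    ∃ m : ℤ, ∀ t, θ t = θ' t + m * (2 * Real.pi) := by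
  obtain ⟨m, hm⟩ := Circle.exp_eq_exp.1 (h 0)
  refine ⟨m, fun t => ?_⟩
  have := Circle.isCoveringMap_exp.eq_of_comp_eq (g₁ := θ)
    (g₂ := fun t => θ' t + m * (2 * Real.pi)) θ.continuous (by fun_prop)
    (by
      funext t
      simp only [Function.comp_apply]
      rw [h t]
      exact (Circle.exp_eq_exp.2 ⟨m, rfl⟩).symm) 0 hm
  exact congrFun this t

theorem windingNumber_spec (γ : C(I, Circle)) (hγ : γ 0 = γ 1) (θ : C(I, ℝ))
    (hθ : ∀ t, Circle.exp (θ t) = γ t) : θ 1 - θ 0 = windingNumber γ * (2 * Real.pi) := by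
  have hs := (exists_circle_lift γ).choose_spec
  set L := (exists_circle_lift γ).choose with hL
  obtain ⟨m, hm⟩ := lift_eq_add θ L (fun t => (hθ t).trans (hs t).symm)
  obtain ⟨k, hk⟩ := Circle.exp_eq_exp.1 (((hs 1).trans hγ.symm).trans (hs 0).symm)
  have hpi : (2 * Real.pi) ≠ 0 := by positivity
  have : windingNumber γ = k := by
    unfold windingNumber
    rw [← hL, hk, add_sub_cancel_left, mul_div_assoc, div_self hpi, mul_one, round_intCast]
  rw [this, hm 1, hm 0, hk]
  ring

theorem windingNumber_eq (γ : C(I, Circle)) (hγ : γ 0 = γ 1) (θ : C(I, ℝ))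
    (hθ : ∀ t, Circle.exp (θ t) = γ t) (k : ℤ) (hk : θ 1 - θ 0 = k * (2 * Real.pi)) :
    windingNumber γ = k := by
  have h := windingNumber_spec γ hγ θ hθ
  rw [hk] at h
  have hpi : (2 * Real.pi) ≠ 0 := by positivity
  exact_mod_cast (mul_right_cancel₀ hpi h).symm

/-- Winding numbers are invariant under homotopies through loops. -/
theorem windingNumber_homotopy (G : C(I × I, Circle)) (hG : ∀ s, G (s, 0) = G (s, 1))
    (γ γ' : C(I, Circle)) (h : ∀ t, G (0, t) = γ t) (h' : ∀ t, G (1, t) = γ' t) :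
    windingNumber γ = windingNumber γ' := by
  obtain ⟨θ, hθ⟩ := exists_circle_lift γ
  have H0 : ∀ a, G (0, a) = Circle.exp (θ a) := fun a => (h a).trans (hθ a).symm
  let Θ := Circle.isCoveringMap_exp.liftHomotopy G θ H0
  have hΘ : ∀ x, Circle.exp (Θ x) = G x := fun x =>
    congrFun (Circle.isCoveringMap_exp.liftHomotopy_lifts G θ H0) x
  obtain ⟨m, hm⟩ := lift_eq_add (Θ.comp ⟨fun s => (s, 1), by fun_prop⟩)
    (Θ.comp ⟨fun s => (s, 0), by fun_prop⟩) (fun s => by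
      simp only [ContinuousMap.comp_apply, ContinuousMap.coe_mk, hΘ, hG])
  simp only [ContinuousMap.comp_apply, ContinuousMap.coe_mk] at hm
  rw [windingNumber_eq γ (by rw [← h, ← h, hG]) (Θ.comp ⟨fun t => (0, t), by fun_prop⟩)
      (fun t => by simp [hΘ, h]) m (by simp [hm]),
    windingNumber_eq γ' (by rw [← h', ← h', hG]) (Θ.comp ⟨fun t => (1, t), by fun_prop⟩)
      (fun t => by simp [hΘ, h']) m (by simp [hm])]

theorem windingNumber_trans {z : Circle} (γ γ' : Path z z) :
    windingNumber (γ.trans γ').toContinuousMap =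
      windingNumber γ.toContinuousMap + windingNumber γ'.toContinuousMap := by
  obtain ⟨θ, hθ⟩ := exists_circle_lift γ.toContinuousMap
  obtain ⟨θ', hθ'⟩ := exists_circle_lift γ'.toContinuousMap
  have e : Circle.exp (θ 1) = Circle.exp (θ' 0) := by rw [hθ, hθ']; simp
  obtain ⟨m, hm⟩ := Circle.exp_eq_exp.1 e
  have w := windingNumber_spec _ (by simp) θ hθ
  have w' := windingNumber_spec _ (by simp) θ' hθ'
  let P : Path (θ 0) (θ 1) := ⟨θ, rfl, rfl⟩
  let P' : Path (θ 1) (θ' 1 + m * (2 * Real.pi)) :=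
    ⟨⟨fun t => θ' t + m * (2 * Real.pi), by fun_prop⟩, hm.symm, rfl⟩
  refine windingNumber_eq _ (by simp) (P.trans P').toContinuousMap (fun t => ?_) _ ?_
  · change Circle.exp ((P.trans P') t) = (γ.trans γ') t
    rw [Path.trans_apply, Path.trans_apply]
    split_ifs with ht
    · exact hθ _
    · refine Eq.trans ?_ (hθ' _)
      exact Circle.exp_eq_exp.2 ⟨m, rfl⟩
  · change (P.trans P') 1 - (P.trans P') 0 = _
    rw [Path.target, Path.source]
    push_cast
    linarith

theorem windingNumber_congr {z : Circle} {γ γ' : Path z z} (h : γ.Homotopic γ') :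
    windingNumber γ.toContinuousMap = windingNumber γ'.toContinuousMap := by
  obtain ⟨F⟩ := h
  exact windingNumber_homotopy F.toContinuousMap (fun s => (F.source s).trans (F.target s).symm)
    _ _ (fun t => F.apply_zero t) (fun t => F.apply_one t)

/-- The degree homomorphism `π₁(𝕊¹, z) → ℤ` (it is the standard isomorphism `π₁(𝕊¹) ≅ ℤ`). -/
def circleDegree (z : Circle) : FundamentalGroup Circle z →* Multiplicative ℤ :=
  MonoidHom.mk' (fun g => Quotient.lift
      (fun γ : Path z z => Multiplicative.ofAdd (windingNumber γ.toContinuousMap))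
      (fun _ _ h => congrArg Multiplicative.ofAdd (windingNumber_congr h)) g.toPath)
    (by
      intro a b
      obtain ⟨γ, rfl⟩ := Path.Homotopic.Quotient.mk_surjective a
      obtain ⟨γ', rfl⟩ := Path.Homotopic.Quotient.mk_surjective b
      change Multiplicative.ofAdd (windingNumber (γ'.trans γ).toContinuousMap) =
        Multiplicative.ofAdd (windingNumber γ.toContinuousMap) *
        Multiplicative.ofAdd (windingNumber γ'.toContinuousMap)
      rw [windingNumber_trans, add_comm, ofAdd_add])

/-! ### The first cohomotopy group and the comparison morphism -/

/-- Free homotopy, as a congruence on the group of continuous maps `X → 𝕊¹` under pointwise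
multiplication. -/
def homotopyCon (X : Type*) [TopologicalSpace X] : Con C(X, Circle) where
  r := ContinuousMap.Homotopic
  iseqv := ContinuousMap.Homotopic.equivalence
  mul' := by
    rintro f f' g g' ⟨F⟩ ⟨G⟩
    exact ⟨{ toContinuousMap := F.toContinuousMap * G.toContinuousMap
             map_zero_left := fun x => by simp
             map_one_left := fun x => by simp }⟩

/-- The first cohomotopy (Bruschlinsky) group `π¹(X) = [X, 𝕊¹]` of free homotopy classes of
continuous maps `X → 𝕊¹`, with the multiplication induced by that of `𝕊¹`. -/
abbrev Cohomotopy (X : Type*) [TopologicalSpace X] : Type _ := (homotopyCon X).Quotient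

/-- The homomorphism `π₁(X, x₀) → π₁(𝕊¹, f x₀) ≅ ℤ` induced by `f : X → 𝕊¹`. -/
def inducedHom {X : Type*} [TopologicalSpace X] (x₀ : X) (f : C(X, Circle)) :
    FundamentalGroup X x₀ →* Multiplicative ℤ :=
  (circleDegree (f x₀)).comp (FundamentalGroup.map f x₀)

theorem inducedHom_mk {X : Type*} [TopologicalSpace X] (x₀ : X) (f : C(X, Circle))
    (γ : Path x₀ x₀) :
    inducedHom x₀ f (FundamentalGroup.fromPath (Path.Homotopic.Quotient.mk γ)) =
      Multiplicative.ofAdd (windingNumber (f.comp γ.toContinuousMap)) := rfl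

/-- The comparison morphism `π¹(X) → Hom(π₁(X, x₀), ℤ)`, sending the class of `f` to the
homomorphism that it induces on fundamental groups. -/
def comparison (X : Type*) [TopologicalSpace X] (x₀ : X) :
    Cohomotopy X →* (FundamentalGroup X x₀ →* Multiplicative ℤ) :=
  (homotopyCon X).lift
    (MonoidHom.mk' (inducedHom x₀) (by
      intro f g
      ext a
      obtain ⟨γ, rfl⟩ := Path.Homotopic.Quotient.mk_surjective a
      have hl : ∀ h : C(X, Circle), (h.comp γ.toContinuousMap) 0 = (h.comp γ.toContinuousMap) 1 :=
        fun h => congrArg h (γ.source.trans γ.target.symm)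
      obtain ⟨θ, hθ⟩ := exists_circle_lift (f.comp γ.toContinuousMap)
      obtain ⟨θ', hθ'⟩ := exists_circle_lift (g.comp γ.toContinuousMap)
      have w := windingNumber_spec _ (hl f) θ hθ
      have w' := windingNumber_spec _ (hl g) θ' hθ'
      change Multiplicative.ofAdd (windingNumber ((f * g).comp γ.toContinuousMap)) =
        Multiplicative.ofAdd (windingNumber (f.comp γ.toContinuousMap)) *
        Multiplicative.ofAdd (windingNumber (g.comp γ.toContinuousMap))
      rw [← ofAdd_add]
      congr 1
      refine windingNumber_eq _ (hl _) (θ + θ') (fun t => ?_) _ ?_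
      · rw [ContinuousMap.add_apply, Circle.exp_add, hθ, hθ']
        rfl
      · push_cast
        change θ 1 + θ' 1 - (θ 0 + θ' 0) = _
        linarith))
    (by
      rintro f g ⟨F⟩
      change inducedHom x₀ f = inducedHom x₀ g
      ext a
      obtain ⟨γ, rfl⟩ := Path.Homotopic.Quotient.mk_surjective a
      refine congrArg Multiplicative.ofAdd (windingNumber_homotopy
        (F.toContinuousMap.comp ⟨fun x : I × I => (x.1, γ x.2), by fun_prop⟩) ?_ _ _ ?_ ?_)
      · intro s
        change F (s, γ 0) = F (s, γ 1)
        rw [γ.source, γ.target]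
      · intro t; exact F.apply_zero _
      · intro t; exact F.apply_one _)

/-! ### Baire-1 functions -/

/-- Countable unions of closed sets. -/
def IsFsigma {X : Type*} [TopologicalSpace X] (s : Set X) : Prop :=
  ∃ F : ℕ → Set X, (∀ k, IsClosed (F k)) ∧ s = ⋃ k, F k

/-- A function is Baire-1 if preimages of open sets are countable unions of closed sets. -/
def IsBaireOne {X Y : Type*} [TopologicalSpace X] [TopologicalSpace Y] (f : X → Y) : Prop :=
  ∀ U : Set Y, IsOpen U → IsFsigma (f ⁻¹' U)

theorem IsFsigma.iUnion {X ι : Type*} [TopologicalSpace X] [Countable ι] {s : ι → Set X}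
    (h : ∀ i, IsFsigma (s i)) : IsFsigma (⋃ i, s i) := by
  choose F hF hs using h
  rcases isEmpty_or_nonempty ι with hι | hι
  · exact ⟨fun _ => ∅, fun _ => isClosed_empty, by simp⟩
  · obtain ⟨e, he⟩ := exists_surjective_nat (ι × ℕ)
    refine ⟨fun k => F (e k).1 (e k).2, fun k => hF _ _, ?_⟩
    rw [he.iUnion_comp (fun x : ι × ℕ => F x.1 x.2), iUnion_prod']
    exact iUnion_congr hs

theorem IsFsigma.inter {X : Type*} [TopologicalSpace X] {s t : Set X}
    (hs : IsFsigma s) (ht : IsFsigma t) : IsFsigma (s ∩ t) := by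
  obtain ⟨F, hF, rfl⟩ := hs
  obtain ⟨G, hG, rfl⟩ := ht
  rw [iUnion_inter_iUnion]
  exact IsFsigma.iUnion fun i => IsFsigma.iUnion fun j =>
    ⟨fun _ => F i ∩ G j, fun _ => (hF i).inter (hG j), (iUnion_const _).symm⟩

/-- The additive group of Baire-1 functions `X → ℤ`. -/
def baireOneSubgroup (X : Type*) [TopologicalSpace X] : AddSubgroup (X → ℤ) where
  carrier := {f | IsBaireOne f}
  zero_mem' := fun U _ => ⟨fun _ => (0 : X → ℤ) ⁻¹' U,
    fun _ => (isClosed_discrete U).preimage continuous_const, (iUnion_const _).symm⟩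
  add_mem' := by
    intro f g hf hg U _
    have : (f + g) ⁻¹' U =
        ⋃ x : {x : ℤ × ℤ // x.1 + x.2 ∈ U}, f ⁻¹' {x.1.1} ∩ g ⁻¹' {x.1.2} := by
      ext y
      simp
    rw [this]
    exact IsFsigma.iUnion fun x =>
      (hf _ (isOpen_discrete _)).inter (hg _ (isOpen_discrete _))
  neg_mem' := by
    intro f hf U _
    exact hf (Neg.neg ⁻¹' U) (isOpen_discrete _)

/-! ### The Prüfer manifold -/

/-- The hyperplane `ℝⁿ⁻¹ = ∂ℍ₊ⁿ`. -/
abbrev Hyperplane (n : ℕ) : Type := EuclideanSpace ℝ (Fin (n - 1))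

/-- The open upper half-space `{(y, t) ∈ ℝⁿ⁻¹ × ℝ | t > 0}`, with its subspace topology. -/
abbrev HalfSpace (n : ℕ) : Type := {x : Hyperplane n × ℝ // 0 < x.2}

/-- The slope `v` of the ray `{(p + t v, t) | t > 0}` through the point `x` of the half-space that
is based at the boundary point `p`. -/
def slope {n : ℕ} (p : Hyperplane n) (x : HalfSpace n) : Hyperplane n :=
  (x.1.2)⁻¹ • (x.1.1 - p)

/-- The filter of tangential convergence to the ray `{(p + t v, t) | t > 0}`: a net `x` in the
half-space converges along it iff `x → p` in `ℝⁿ` and the rays from `p` through `x` converge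
to that ray. -/
def tangentialFilter {n : ℕ} (p v : Hyperplane n) : Filter (HalfSpace n) :=
  comap (fun x : HalfSpace n => (x.1, slope p x)) (𝓝 ((p, 0), v))

/-- The underlying set of the bordered Prüfer manifold: the disjoint union of the open upper
half-space and, for each `p ∈ S`, of the set of rays `{(p + t v, t) | t > 0}` in it based at `p`.
Rays based at `p` are given by their slope `v ∈ ℝⁿ⁻¹`, the affine coordinate on the open subset
of the projective space of lines through `p` that consists of the lines not contained
in the boundary hyperplane. -/
inductive Bordered (n : ℕ) (S : Set (Hyperplane n)) : Type
  | inner (x : HalfSpace n) : Bordered n S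
  | ray (p : S) (v : Hyperplane n) : Bordered n S

/-- A set is open iff its trace on the half-space and on each set of rays at a common base point
is open, and every net in the half-space that converges tangentially to a ray in
the set is eventually in the set. -/
instance (n : ℕ) (S : Set (Hyperplane n)) : TopologicalSpace (Bordered n S) where
  IsOpen U := IsOpen (Bordered.inner ⁻¹' U) ∧ (∀ p, IsOpen (Bordered.ray p ⁻¹' U)) ∧
    ∀ p v, Bordered.ray p v ∈ U → ∀ᶠ x in tangentialFilter p.1 v, Bordered.inner x ∈ U
  isOpen_univ := ⟨isOpen_univ, fun _ => isOpen_univ, fun _ _ _ => Eventually.of_forall fun _ => trivial⟩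
  isOpen_inter := fun _ _ h h' => ⟨h.1.inter h'.1, fun p => (h.2.1 p).inter (h'.2.1 p),
    fun p v hv => (h.2.2 p v hv.1).and (h'.2.2 p v hv.2)⟩
  isOpen_sUnion := by
    intro C hC
    refine ⟨?_, fun p => ?_, ?_⟩
    · rw [preimage_sUnion]
      exact isOpen_biUnion fun U hU => (hC U hU).1
    · rw [preimage_sUnion]
      exact isOpen_biUnion fun U hU => (hC U hU).2.1 p
    · rintro p v ⟨U, hU, hv⟩
      exact ((hC U hU).2.2 p v hv).mono fun x hx => ⟨U, hU, hx⟩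

theorem isOpen_bordered_iff {n : ℕ} {S : Set (Hyperplane n)} {U : Set (Bordered n S)} :
    IsOpen U ↔ IsOpen (Bordered.inner ⁻¹' U) ∧ (∀ p, IsOpen (Bordered.ray p ⁻¹' U)) ∧
      ∀ p v, Bordered.ray p v ∈ U → ∀ᶠ x in tangentialFilter p.1 v, Bordered.inner x ∈ U :=
  Iff.rfl

/-- The gluing of two copies of the bordered Prüfer manifold, indexed by `Bool`,
along the rays. -/
def doubleSetoid (n : ℕ) (S : Set (Hyperplane n)) : Setoid (Bool × Bordered n S) where
  r a b := a.2 = b.2 ∧ (a.1 = b.1 ∨ ∃ p v, a.2 = Bordered.ray p v)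
  iseqv := by
    refine ⟨fun a => ⟨rfl, Or.inl rfl⟩, ?_, ?_⟩
    · rintro ⟨i, a⟩ ⟨j, b⟩ ⟨h, h'⟩
      dsimp only at h h' ⊢
      subst h
      exact ⟨rfl, h'.imp Eq.symm id⟩
    · rintro ⟨i, a⟩ ⟨j, b⟩ ⟨k, c⟩ ⟨h, h'⟩ ⟨g, g'⟩
      dsimp only at h h' g g' ⊢
      subst h
      subst g
      refine ⟨rfl, ?_⟩
      rcases h' with rfl | h'
      · exact g'
      · exact Or.inr h'

/-- The (boundary-less) Prüfer `n`-manifold over `S`, with the quotient topology: the double of the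
bordered one. -/
def Manifold (n : ℕ) (S : Set (Hyperplane n)) : Type := Quotient (doubleSetoid n S)

instance (n : ℕ) (S : Set (Hyperplane n)) : TopologicalSpace (Manifold n S) :=
  inferInstanceAs (TopologicalSpace (Quotient (doubleSetoid n S)))

/-- The inclusion of the copy of the bordered Prüfer manifold with index `i`; `true` is the first
copy and `false` the second one. -/
def incl {n : ℕ} {S : Set (Hyperplane n)} (i : Bool) (x : Bordered n S) : Manifold n S :=
  Quotient.mk (doubleSetoid n S) (i, x)

theorem continuous_incl {n : ℕ} {S : Set (Hyperplane n)} (i : Bool) :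
    Continuous (incl i : Bordered n S → Manifold n S) :=
  continuous_quotient_mk'.comp (by fun_prop)

theorem incl_ray {n : ℕ} {S : Set (Hyperplane n)} (i j : Bool) (p : S) (v : Hyperplane n) :
    incl i (Bordered.ray p v) = incl j (Bordered.ray p v) :=
  Quotient.sound ⟨rfl, Or.inr ⟨p, v, rfl⟩⟩

/-! ### The loops `α_{p,q}` -/

/-- The height of the semicircle with diameter `[p, q]` over `p + s (q - p)`. -/
def arcHeight {n : ℕ} (p q : Hyperplane n) (s : ℝ) : ℝ := √(s * (1 - s)) * ‖q - p‖

/-- The semicircle with diameter `[p, q]`, as a map from `[0,1]` to the bordered Prüfer manifold,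
running from the vertical ray at `p` to the vertical ray at `q` (it is constant if `p = q`). -/
def arcFun {n : ℕ} {S : Set (Hyperplane n)} (p q : S) (s : I) : Bordered n S :=
  if h : 0 < arcHeight p.1 q.1 s then
    Bordered.inner ⟨(p.1 + (s : ℝ) • (q.1 - p.1), arcHeight p.1 q.1 s), h⟩
  else if s = 0 then Bordered.ray p 0 else Bordered.ray q 0

theorem arcHeight_pos {n : ℕ} {p q : Hyperplane n} (h : p ≠ q) {s : ℝ} (h0 : 0 < s) (h1 : s < 1) :
    0 < arcHeight p q s :=
  mul_pos (Real.sqrt_pos.2 (mul_pos h0 (sub_pos.2 h1))) (norm_pos_iff.2 (sub_ne_zero.2 h.symm))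

theorem continuous_arcHeight {n : ℕ} (p q : Hyperplane n) :
    Continuous fun s : I => arcHeight p q s := by
  unfold arcHeight
  fun_prop

theorem arcFun_mem_nhds {n : ℕ} {S : Set (Hyperplane n)} (p q b : S) (s₀ : I)
    (hb : p.1 + (s₀ : ℝ) • (q.1 - p.1) = b.1) (h₀ : arcHeight p.1 q.1 s₀ = 0)
    (ha : arcFun p q s₀ = Bordered.ray b 0) (ψ : I → Hyperplane n) (hψ : ContinuousAt ψ s₀)
    (hψ₀ : ψ s₀ = 0)
    (hs : ∀ᶠ s : I in 𝓝 s₀, s = s₀ ∨ 0 < arcHeight p.1 q.1 s ∧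
      (arcHeight p.1 q.1 s)⁻¹ • (p.1 + (s : ℝ) • (q.1 - p.1) - b.1) = ψ s)
    (U : Set (Bordered n S)) (hU : IsOpen U) (hm : arcFun p q s₀ ∈ U) :
    arcFun p q ⁻¹' U ∈ 𝓝 s₀ := by
  rw [ha] at hm
  obtain ⟨V, hV, hVU⟩ := mem_comap.1 ((isOpen_bordered_iff.1 hU).2.2 b 0 hm)
  have ht : ContinuousAt (fun s : I =>
      ((p.1 + (s : ℝ) • (q.1 - p.1), arcHeight p.1 q.1 s), ψ s)) s₀ :=
    ((by fun_prop : Continuous fun s : I => p.1 + (s : ℝ) • (q.1 - p.1)).continuousAt.prodMk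
      (continuous_arcHeight p.1 q.1).continuousAt).prodMk hψ
  have ht' := ht.preimage_mem_nhds (t := V) (by rw [hb, h₀, hψ₀]; exact hV)
  filter_upwards [ht', hs] with s hsV hs
  rcases hs with rfl | ⟨hpos, hsl⟩
  · rw [mem_preimage, ha]
    exact hm
  · rw [mem_preimage, arcFun, dif_pos hpos]
    refine hVU (?_ : ((_, _) : _ × _) ∈ V)
    rw [slope]
    change (_, (arcHeight p.1 q.1 s)⁻¹ • (p.1 + (s : ℝ) • (q.1 - p.1) - b.1)) ∈ V
    rw [hsl]
    exact hsV

theorem arc_ratio {a b L : ℝ} (ha : 0 < a) (hb : 0 < b) :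
    (√(a * b) * L)⁻¹ * a = √a * (√b * L)⁻¹ := by
  have h := Real.sqrt_pos.2 ha
  have h' := Real.sqrt_pos.2 hb
  rw [Real.sqrt_mul ha.le, mul_assoc, mul_inv]
  nth_rewrite 2 [← Real.mul_self_sqrt ha.le]
  field_simp

theorem continuous_arcFun {n : ℕ} {S : Set (Hyperplane n)} (p q : S) :
    Continuous (arcFun p q) := by
  rcases eq_or_ne p q with rfl | hpq
  · have : arcFun p p = fun _ => Bordered.ray p 0 := by
      funext s
      simp [arcFun, arcHeight]
    rw [this]
    exact continuous_const
  have hpq' : p.1 ≠ q.1 := fun h => hpq (Subtype.ext h)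
  have hL : ‖q.1 - p.1‖ ≠ 0 := norm_ne_zero_iff.2 (sub_ne_zero.2 hpq'.symm)
  refine continuous_def.2 fun U hU => isOpen_iff_mem_nhds.2 fun s₀ hs₀ => ?_
  rcases eq_or_ne s₀ 0 with rfl | h0
  · refine arcFun_mem_nhds p q p 0 (by simp) (by simp [arcHeight]) (by simp [arcFun, arcHeight])
      (fun s => √(s : ℝ) • ((√(1 - (s : ℝ)) * ‖q.1 - p.1‖)⁻¹ • (q.1 - p.1))) ?_ (by simp) ?_ U hU hs₀
    · refine ContinuousAt.smul (f := fun s : I => √(s : ℝ)) (by fun_prop)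
        (ContinuousAt.smul (f := fun s : I => (√(1 - (s : ℝ)) * ‖q.1 - p.1‖)⁻¹)
          (ContinuousAt.inv₀ (f := fun s : I => √(1 - (s : ℝ)) * ‖q.1 - p.1‖) (by fun_prop) ?_)
          continuousAt_const)
      simpa using hL
    · filter_upwards [isOpen_Iio.mem_nhds (show (0 : I) < 1 from zero_lt_one)] with s hs
      rcases eq_or_ne s 0 with h | h
      · exact Or.inl h
      · have hs0 : 0 < (s : ℝ) := unitInterval.pos_iff_ne_zero.2 h
        have hs1 : (s : ℝ) < 1 := hs
        refine Or.inr ⟨arcHeight_pos hpq' hs0 hs1, ?_⟩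
        rw [add_sub_cancel_left, arcHeight, smul_smul, smul_smul, arc_ratio hs0 (sub_pos.2 hs1)]
  rcases eq_or_ne s₀ 1 with rfl | h1
  · refine arcFun_mem_nhds p q q 1 (by simp) (by simp [arcHeight]) (by simp [arcFun, arcHeight])
      (fun s => √(1 - (s : ℝ)) • ((√(s : ℝ) * ‖q.1 - p.1‖)⁻¹ • (p.1 - q.1))) ?_ (by simp) ?_ U hU hs₀
    · refine ContinuousAt.smul (f := fun s : I => √(1 - (s : ℝ))) (by fun_prop)
        (ContinuousAt.smul (f := fun s : I => (√(s : ℝ) * ‖q.1 - p.1‖)⁻¹)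
          (ContinuousAt.inv₀ (f := fun s : I => √(s : ℝ) * ‖q.1 - p.1‖) (by fun_prop) ?_)
          continuousAt_const)
      simpa using hL
    · filter_upwards [isOpen_Ioi.mem_nhds (show (0 : I) < 1 from zero_lt_one)] with s hs
      rcases eq_or_ne s 1 with h | h
      · exact Or.inl h
      · have hs0 : 0 < (s : ℝ) := hs
        have hs1 : (s : ℝ) < 1 := unitInterval.lt_one_iff_ne_one.2 h
        refine Or.inr ⟨arcHeight_pos hpq' hs0 hs1, ?_⟩
        have e : p.1 + (s : ℝ) • (q.1 - p.1) - q.1 = (1 - (s : ℝ)) • (p.1 - q.1) := by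
          module
        rw [e, arcHeight, smul_smul, smul_smul, mul_comm (s : ℝ), arc_ratio (sub_pos.2 hs1) hs0]
  have hpos : 0 < arcHeight p.1 q.1 s₀ :=
    arcHeight_pos hpq' (unitInterval.pos_iff_ne_zero.2 h0) (unitInterval.lt_one_iff_ne_one.2 h1)
  rw [mem_preimage, arcFun, dif_pos hpos] at hs₀
  obtain ⟨V, hV, hVU⟩ := isOpen_induced_iff.1 (isOpen_bordered_iff.1 hU).1
  have hmem : ∀ s : I, ∀ h : 0 < arcHeight p.1 q.1 s,
      (p.1 + (s : ℝ) • (q.1 - p.1), arcHeight p.1 q.1 s) ∈ V ↔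
        Bordered.inner ⟨(p.1 + (s : ℝ) • (q.1 - p.1), arcHeight p.1 q.1 s), h⟩ ∈ U := fun s h =>
    Set.ext_iff.1 hVU ⟨_, h⟩
  have hc : Continuous fun s : I => (p.1 + (s : ℝ) • (q.1 - p.1), arcHeight p.1 q.1 s) :=
    (by fun_prop : Continuous fun s : I => p.1 + (s : ℝ) • (q.1 - p.1)).prodMk
      (continuous_arcHeight p.1 q.1)
  filter_upwards [hc.continuousAt.preimage_mem_nhds (hV.mem_nhds ((hmem s₀ hpos).2 hs₀)),
    (isOpen_Ioi.preimage (continuous_arcHeight p.1 q.1)).mem_nhds hpos] with s h h'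
  have h'' : 0 < arcHeight p.1 q.1 s := h'
  rw [mem_preimage, arcFun, dif_pos h'']
  exact (hmem s h'').1 h

/-- The path `α⁺_{p,q}`. -/
def arc {n : ℕ} {S : Set (Hyperplane n)} (p q : S) :
    Path (Bordered.ray p 0 : Bordered n S) (Bordered.ray q 0) where
  toFun := arcFun p q
  continuous_toFun := continuous_arcFun p q
  source' := by simp [arcFun, arcHeight]
  target' := by simp [arcFun, arcHeight]

/-- The vertical ray at `p`, as a point of the Prüfer manifold. -/
def verticalRay {n : ℕ} {S : Set (Hyperplane n)} (p : S) : Manifold n S :=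
  incl true (Bordered.ray p 0)

/-- The loop `α_{p,q}`: the semicircle from the vertical ray at `p` to the vertical ray at `q` in
the first copy, followed by the reversal of its mirror image in the second copy. -/
def loop {n : ℕ} {S : Set (Hyperplane n)} (p q : S) :
    Path (verticalRay p : Manifold n S) (verticalRay p) :=
  ((arc p q).map (continuous_incl true)).trans
    (((arc p q).map (continuous_incl false)).symm.cast
      (incl_ray true false q 0) (incl_ray true false p 0))

/-- The class of `α_{p,q}` in the fundamental group based at the vertical ray at `p`. -/
def loopClass {n : ℕ} {S : Set (Hyperplane n)} (p q : S) :
    FundamentalGroup (Manifold n S) (verticalRay p) :=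
  FundamentalGroup.fromPath (Path.Homotopic.Quotient.mk (loop p q))

/-- The set `S ∖ {p₀}`, with its subspace topology. -/
abbrev Punctured {n : ℕ} {S : Set (Hyperplane n)} (p₀ : S) : Type := {p : S // p ≠ p₀}

/-- Evaluation of homomorphisms `π₁ → ℤ` on the classes of the loops `α_{p₀,p}`, `p ≠ p₀`, as an
additive homomorphism `Hom(π₁, ℤ) → ℤ^(S ∖ {p₀})`. -/
def evalOnLoops {n : ℕ} {S : Set (Hyperplane n)} (p₀ : S) :
    Additive (FundamentalGroup (Manifold n S) (verticalRay p₀) →* Multiplicative ℤ) →+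
      (Punctured p₀ → ℤ) where
  toFun φ p := (φ.toMul (loopClass p₀ p.1)).toAdd
  map_zero' := rfl
  map_add' _ _ := rfl

end Prufer

end

noncomputable section

namespace Prufer

variable {n : ℕ} {S : Set (Hyperplane n)}

/-! ### Neighbourhoods in the bordered Prüfer manifold -/

/-! Slope at `p` and signed height form a chart from ℝⁿ⁻¹ × ℝ onto the union of the two open
half-spaces and the rays at `p` (`isOpenEmbedding_chart`). These domains are contractible and open,
they cover the manifold, and two different ones meet exactly in the two half-spaces. For the
fundamental group the manifold thus behaves like a graph with two vertices, the half-spaces, and one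
edge for each `p`; the loop at `p` runs along edge `p` and back along edge `p₀`.

Freeness has two halves. There are no relations because a covering with the free group as fibre,
glued from trivial pieces by constant transition functions, has a monodromy that recovers every
reduced word (`monodromy_loopClass`, `lift_loopClass_injective`). The loops generate because a path
can be followed chart by chart, and the choice of a return route to the base point only matters up
to loop classes (`admissible_of_mem`, `eq_top_of_loopClass_mem`).

A circle-valued map has real lifts on both bordered copies (`exists_lift_bordered`). On the rays at
`p` they differ by 2π times an integer m(p), and the winding number along the loop is m(p) - m(p₀)
(`windingNumber_loop`). If all of these vanish, the lifts glue after a shift and the map is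
null-homotopic, which gives injectivity. In general, the difference of the lifts at (p, 1/(j+1)) is
continuous in p and tends to 2π m(p), so the winding numbers are Baire-1.

Conversely, the level sets of a Baire-1 function split into countably many relatively closed pieces.
A continuous function on the half-space can be built that near each ray at `p` is constant, equal to
the value on the first piece that contains `p` (`eventually_blend_eq`). Exponentiating 2π times this
function on one copy, and taking 1 on the other, realises the prescribed winding numbers
(`exists_map_of_limits`). -/

theorem continuous_slope (p : Hyperplane n) : Continuous (slope p : HalfSpace n → Hyperplane n) :=
  Continuous.smul (f := fun x : HalfSpace n => (x.1.2)⁻¹) (g := fun x : HalfSpace n => x.1.1 - p)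
    (Continuous.inv₀ (by fun_prop) fun x => x.2.ne') (by fun_prop)

/-- The filter is pulled back from neighbourhoods of `((p, 0), v)`, so a neighbourhood that works
for `v` also works for nearby slopes. This and the next lemma supply the openness needed in
`mem_nhds_ray`. -/
theorem eventually_tangentialFilter {p v : Hyperplane n} {P : HalfSpace n → Prop}
    (h : ∀ᶠ x in tangentialFilter p v, P x) :
    ∀ᶠ w in 𝓝 v, ∀ᶠ x in tangentialFilter p w, P x := by
  rw [tangentialFilter, eventually_comap] at h
  have hc : Tendsto (fun w : Hyperplane n => ((p, (0 : ℝ)), w)) (𝓝 v) (𝓝 ((p, 0), v)) :=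
    Continuous.tendsto (by fun_prop) v
  filter_upwards [hc.eventually (eventually_eventually_nhds.2 h)] with w hw
  rw [tangentialFilter, eventually_comap]
  exact hw

theorem eventually_tangentialFilter_nhds {p v : Hyperplane n} {P : HalfSpace n → Prop}
    (h : ∀ᶠ x in tangentialFilter p v, P x) :
    ∀ᶠ x in tangentialFilter p v, ∀ᶠ y in 𝓝 x, P y := by
  rw [tangentialFilter, eventually_comap] at h ⊢
  filter_upwards [eventually_eventually_nhds.2 h] with z hz x hx
  subst hx
  have hc : Continuous fun x : HalfSpace n => (x.1, slope p x) :=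
    continuous_subtype_val.prodMk (continuous_slope p)
  filter_upwards [hc.continuousAt.eventually hz] with y hy
  exact hy y rfl

theorem mem_nhds_ray {p : S} {v : Hyperplane n} {U : Set (Bordered n S)} :
    U ∈ 𝓝 (Bordered.ray p v) ↔ (∀ᶠ w in 𝓝 v, Bordered.ray p w ∈ U) ∧
      ∀ᶠ x in tangentialFilter p.1 v, Bordered.inner x ∈ U := by
  constructor
  · intro h
    obtain ⟨V, hVU, hV, hx⟩ := mem_nhds_iff.1 h
    rw [isOpen_bordered_iff] at hV
    exact ⟨mem_of_superset ((hV.2.1 p).mem_nhds hx) fun y hy => hVU hy,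
      (hV.2.2 p v hx).mono fun y hy => hVU hy⟩
  · rintro ⟨h₁, h₂⟩
    have hinj : ∀ q : S, Function.Injective (Bordered.ray q : Hyperplane n → Bordered n S) :=
      fun q _ _ h => (Bordered.ray.inj h).2
    have hinner : Function.Injective (Bordered.inner : HalfSpace n → Bordered n S) :=
      fun _ _ h => Bordered.inner.inj h
    -- The witness collects the points where the neighbourhood conditions hold. Rays at other base
    -- points can be left out, since the rays at `p` and the half-space already form an open set.
    refine mem_nhds_iff.2 ⟨Bordered.inner '' {x | ∀ᶠ y in 𝓝 x, Bordered.inner y ∈ U} ∪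
      Bordered.ray p '' {w | (∀ᶠ w' in 𝓝 w, Bordered.ray p w' ∈ U) ∧
        ∀ᶠ x in tangentialFilter p.1 w, Bordered.inner x ∈ U}, ?_, ?_, ?_⟩
    · rintro _ (⟨x, hx, rfl⟩ | ⟨w, hw, rfl⟩)
      · exact hx.self_of_nhds
      · exact hw.1.self_of_nhds
    · refine isOpen_bordered_iff.2 ⟨?_, fun q => ?_, fun q w hw => ?_⟩
      · have : Bordered.inner ⁻¹' (Bordered.inner '' {x | ∀ᶠ y in 𝓝 x, Bordered.inner y ∈ U} ∪
            Bordered.ray p '' {w | (∀ᶠ w' in 𝓝 w, Bordered.ray p w' ∈ U) ∧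
            ∀ᶠ x in tangentialFilter p.1 w, Bordered.inner x ∈ U}) =
            {x | ∀ᶠ y in 𝓝 x, Bordered.inner y ∈ U} := by
          ext x
          simp
        rw [this]
        exact isOpen_iff_mem_nhds.2 fun x hx => eventually_eventually_nhds.2 hx
      · refine isOpen_iff_mem_nhds.2 fun w hw => ?_
        rcases hw with ⟨x, -, hx⟩ | ⟨w', hw', hx⟩
        · cases hx
        · cases hx
          filter_upwards [eventually_eventually_nhds.2 hw'.1, eventually_tangentialFilter hw'.2]
            with z h h'
          exact Or.inr ⟨z, ⟨h, h'⟩, rfl⟩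
      · rcases hw with ⟨x, -, hx⟩ | ⟨w', hw', hx⟩
        · cases hx
        · cases hx
          filter_upwards [eventually_tangentialFilter_nhds hw'.2] with x hx
          exact Or.inl ⟨x, hx, rfl⟩
    · exact Or.inr ⟨v, ⟨h₁, h₂⟩, rfl⟩

theorem tendsto_tangentialFilter (p v : Hyperplane n) :
    Tendsto (fun x : HalfSpace n => (x.1, slope p x)) (tangentialFilter p v) (𝓝 ((p, 0), v)) :=
  tendsto_comap

theorem continuous_inner : Continuous (Bordered.inner : HalfSpace n → Bordered n S) :=
  continuous_def.2 fun _ hU => (isOpen_bordered_iff.1 hU).1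

theorem continuous_ray (p : S) : Continuous (Bordered.ray p : Hyperplane n → Bordered n S) :=
  continuous_def.2 fun _ hU => (isOpen_bordered_iff.1 hU).2.1 p

theorem continuous_bordered {Y : Type*} [TopologicalSpace Y] {f : Bordered n S → Y}
    (h : Continuous fun x => f (Bordered.inner x)) (h' : ∀ p, Continuous fun v => f (Bordered.ray p v))
    (ht : ∀ (p : S) v, Tendsto (fun x => f (Bordered.inner x)) (tangentialFilter p.1 v)
      (𝓝 (f (Bordered.ray p v)))) : Continuous f :=
  continuous_def.2 fun _ hU => isOpen_bordered_iff.2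
    ⟨hU.preimage h, fun p => hU.preimage (h' p), fun p v hv => ht p v (hU.mem_nhds hv)⟩

/-! ### Points of the Prüfer manifold -/

theorem incl_eq_incl {i j : Bool} {a b : Bordered n S} :
    incl i a = incl j b ↔ a = b ∧ (i = j ∨ ∃ p v, a = Bordered.ray p v) :=
  Quotient.eq (r := doubleSetoid n S)

theorem exists_incl (x : Manifold n S) : ∃ i b, x = incl i b := by
  obtain ⟨⟨i, b⟩, rfl⟩ := Quotient.exists_rep x
  exact ⟨i, b, rfl⟩

theorem isOpen_manifold {U : Set (Manifold n S)} : IsOpen U ↔ ∀ i, IsOpen (incl i ⁻¹' U) := by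
  refine ⟨fun h i => h.preimage (continuous_incl i), fun h => ?_⟩
  refine isOpen_coinduced.2 (isOpen_prod_iff.2 fun i b hb => ?_)
  exact ⟨{i}, incl i ⁻¹' U, isOpen_discrete _, h i, rfl, hb, fun ⟨j, c⟩ ⟨hj, hc⟩ => by
    obtain rfl : j = i := hj
    exact hc⟩

theorem continuous_manifold {Y : Type*} [TopologicalSpace Y] {f : Manifold n S → Y}
    (h : ∀ i, Continuous fun b => f (incl i b)) : Continuous f :=
  continuous_def.2 fun _ hU => isOpen_manifold.2 fun i => hU.preimage (h i)

/-! ### Charts -/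

/-- The collar of the rays at `p`: the point of height `t` on the ray with slope `v` if `0 < t`, and
the ray itself otherwise. -/
def collar (p : S) (z : Hyperplane n × ℝ) : Bordered n S :=
  if h : 0 < z.2 then Bordered.inner ⟨(p.1 + z.2 • z.1, z.2), h⟩ else Bordered.ray p z.1

theorem collar_of_pos (p : S) {z : Hyperplane n × ℝ} (h : 0 < z.2) :
    collar p z = Bordered.inner ⟨(p.1 + z.2 • z.1, z.2), h⟩ := dif_pos h

theorem collar_of_nonpos (p : S) {z : Hyperplane n × ℝ} (h : z.2 ≤ 0) :
    collar p z = Bordered.ray p z.1 := dif_neg h.not_gt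

theorem slope_collar (p v : Hyperplane n) {t : ℝ} (h : 0 < t) :
    slope p ⟨(p + t • v, t), h⟩ = v := by
  simp [slope, smul_smul, h.ne']

theorem collar_slope (p : S) (x : HalfSpace n) :
    collar p (slope p.1 x, x.1.2) = Bordered.inner x := by
  rw [collar_of_pos p (z := (slope p.1 x, x.1.2)) x.2]
  congr 1
  refine Subtype.ext (Prod.ext ?_ rfl)
  simp [slope, smul_smul, x.2.ne']

theorem continuous_collar (p : S) : Continuous (collar p) := by
  refine continuous_def.2 fun U hU => isOpen_iff_mem_nhds.2 fun z hz => ?_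
  have hray : z.2 ≤ 0 → ∀ᶠ z' in 𝓝 z, Bordered.ray p z'.1 ∈ U := fun h => by
    rw [mem_preimage, collar_of_nonpos p h] at hz
    exact (((continuous_ray p).comp continuous_fst).isOpen_preimage U hU).mem_nhds hz
  rcases lt_trichotomy z.2 0 with h | h | h
  · filter_upwards [hray h.le, continuous_snd.continuousAt.eventually (eventually_lt_nhds h)]
      with z' h₁ h₂
    rwa [mem_preimage, collar_of_nonpos p h₂.le]
  · have hz' := hz
    rw [mem_preimage, collar_of_nonpos p h.le] at hz'
    have ht := (mem_nhds_ray.1 (hU.mem_nhds hz')).2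
    rw [tangentialFilter, eventually_comap] at ht
    have hc : ContinuousAt (fun z : Hyperplane n × ℝ => ((p.1 + z.2 • z.1, z.2), z.1)) z :=
      Continuous.continuousAt (by fun_prop)
    have hc' : Tendsto (fun z : Hyperplane n × ℝ => ((p.1 + z.2 • z.1, z.2), z.1)) (𝓝 z)
        (𝓝 ((p.1, 0), z.1)) := by
      simpa [ContinuousAt, h] using hc
    -- At height zero both sides matter: nonpositive heights give rays, positive heights give points
    -- that converge tangentially because their slope at `p` is exactly `z'.1`.
    filter_upwards [hray h.le, hc'.eventually ht] with z' h₁ h₂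
    rcases le_or_gt z'.2 0 with h' | h'
    · rwa [mem_preimage, collar_of_nonpos p h']
    · rw [mem_preimage, collar_of_pos p h']
      exact h₂ _ (by rw [slope_collar])
  · rw [mem_preimage, collar_of_pos p h] at hz
    obtain ⟨V, hV, hVU⟩ := isOpen_induced_iff.1 (isOpen_bordered_iff.1 hU).1
    have hmem : ∀ z : Hyperplane n × ℝ, ∀ h : 0 < z.2, (p.1 + z.2 • z.1, z.2) ∈ V ↔
        Bordered.inner ⟨(p.1 + z.2 • z.1, z.2), h⟩ ∈ U := fun z h => Set.ext_iff.1 hVU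
        ⟨(p.1 + z.2 • z.1, z.2), h⟩
    have hc : Continuous fun z : Hyperplane n × ℝ => (p.1 + z.2 • z.1, z.2) := by fun_prop
    filter_upwards [hc.continuousAt.preimage_mem_nhds (hV.mem_nhds ((hmem z h).2 hz)),
      continuous_snd.continuousAt.eventually (eventually_gt_nhds h)] with z' h₁ h₂
    rw [mem_preimage, collar_of_pos p h₂]
    exact (hmem z' h₂).1 h₁

/-- The chart of the Prüfer manifold given by slopes at `p` and signed heights. -/
def chart (p : S) (z : Hyperplane n × ℝ) : Manifold n S :=
  if 0 ≤ z.2 then incl true (collar p z) else incl false (collar p (z.1, -z.2))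

/-- The height coordinate in a chart, positive in the first copy and negative in the second. -/
def signedHeight (i : Bool) (t : ℝ) : ℝ := if i then t else -t

theorem continuous_signedHeight (i : Bool) : Continuous (signedHeight i) := by
  cases i
  · exact continuous_neg
  · exact continuous_id

theorem signedHeight_zero (i : Bool) : signedHeight i 0 = 0 := by
  cases i <;> simp [signedHeight]

theorem chart_slope (p : S) (i : Bool) (x : HalfSpace n) :
    chart p (slope p.1 x, signedHeight i x.1.2) = incl i (Bordered.inner x) := by
  cases i
  · simp [chart, signedHeight, x.2, collar_slope]
  · simp [chart, signedHeight, x.2.le, collar_slope]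

theorem chart_zero (p : S) (i : Bool) (v : Hyperplane n) :
    chart p (v, 0) = incl i (Bordered.ray p v) := by
  rw [incl_ray i true, chart, if_pos le_rfl, collar_of_nonpos p le_rfl]

theorem chart_cases (p : S) (z : Hyperplane n × ℝ) :
    (z.2 = 0 ∧ chart p z = incl true (Bordered.ray p z.1)) ∨
      ∃ i x, z = (slope p.1 x, signedHeight i x.1.2) ∧ chart p z = incl i (Bordered.inner x) := by
  obtain ⟨v, t⟩ := z
  rcases lt_trichotomy t 0 with h | rfl | h
  · right
    have h' : 0 < -t := neg_pos.2 h
    have e : (v, t) = (slope p.1 ⟨(p.1 + (-t) • v, -t), h'⟩, signedHeight false (-t)) := by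
      rw [slope_collar]
      simp [signedHeight]
    exact ⟨false, ⟨(p.1 + (-t) • v, -t), h'⟩, e, by rw [← chart_slope p, ← e]⟩
  · exact Or.inl ⟨rfl, chart_zero p true v⟩
  · right
    have e : (v, t) = (slope p.1 ⟨(p.1 + t • v, t), h⟩, signedHeight true t) := by
      rw [slope_collar]
      simp [signedHeight]
    exact ⟨true, ⟨(p.1 + t • v, t), h⟩, e, by rw [← chart_slope p, ← e]⟩

theorem continuous_chart (p : S) : Continuous (chart p) := by
  refine Continuous.if_le ((continuous_incl true).comp (continuous_collar p))
    ((continuous_incl false).comp ((continuous_collar p).comp (by fun_prop))) continuous_const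
    continuous_snd ?_
  rintro ⟨v, t⟩ (rfl : 0 = t)
  simp [collar_of_nonpos, incl_ray true false]

theorem chart_injective (p : S) : Function.Injective (chart p) := by
  intro z w h
  rcases chart_cases p z with ⟨hz, hz'⟩ | ⟨i, x, hz, hz'⟩ <;>
    rcases chart_cases p w with ⟨hw, hw'⟩ | ⟨j, y, hw, hw'⟩ <;>
    rw [hz', hw', incl_eq_incl] at h
  · exact Prod.ext (Bordered.ray.inj h.1).2 (hz.trans hw.symm)
  · exact absurd h.1 (by simp)
  · exact absurd h.1 (by simp)
  · obtain ⟨h, rfl | ⟨_, _, h'⟩⟩ := h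
    · obtain rfl := Bordered.inner.inj h
      rw [hz, hw]
    · cases h'

/-- The inverse coordinates are slope and signed height. They are continuous on the half-spaces and
tend to `(v, 0)` along the tangential filter at a ray of `p`; rays at other base points do not meet
the image. -/
theorem isOpenMap_chart (p : S) : IsOpenMap (chart p) := by
  refine fun U hU => isOpen_manifold.2 fun i => ?_
  have hin : ∀ x, incl i (Bordered.inner x) ∈ chart p '' U ↔
      (slope p.1 x, signedHeight i x.1.2) ∈ U := fun x => by
    rw [← chart_slope p, (chart_injective p).mem_set_image]
  have hc : Continuous fun z : (Hyperplane n × ℝ) × Hyperplane n => (z.2, signedHeight i z.1.2) :=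
    continuous_snd.prodMk ((continuous_signedHeight i).comp (by fun_prop))
  refine isOpen_bordered_iff.2 ⟨?_, fun q => ?_, fun q v hv => ?_⟩
  · have : Bordered.inner ⁻¹' (incl i ⁻¹' (chart p '' U)) =
        (fun x : HalfSpace n => (slope p.1 x, signedHeight i x.1.2)) ⁻¹' U := by
      ext x
      exact hin x
    rw [this]
    exact hU.preimage ((continuous_slope p.1).prodMk ((continuous_signedHeight i).comp (by fun_prop)))
  · rcases eq_or_ne q p with rfl | hq
    · have : Bordered.ray q ⁻¹' (incl i ⁻¹' (chart q '' U)) =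
          (fun v : Hyperplane n => (v, (0 : ℝ))) ⁻¹' U := by
        ext v
        rw [mem_preimage, mem_preimage, ← chart_zero, (chart_injective q).mem_set_image]
        rfl
      rw [this]
      exact hU.preimage (by fun_prop)
    · convert isOpen_empty
      refine eq_empty_of_forall_notMem fun v hv => ?_
      obtain ⟨z, -, hz⟩ := hv
      rcases chart_cases p z with ⟨-, hz'⟩ | ⟨i, x, -, hz'⟩ <;> rw [hz', incl_eq_incl] at hz
      · exact hq (Bordered.ray.inj hz.1).1.symm
      · cases hz.1
  · obtain ⟨z, hzU, hz⟩ := hv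
    rcases chart_cases p z with ⟨h0, hz'⟩ | ⟨i, x, -, hz'⟩ <;> rw [hz', incl_eq_incl] at hz
    · obtain ⟨rfl, rfl⟩ := Bordered.ray.inj hz.1
      have ht := (hc.tendsto _).comp (tendsto_tangentialFilter p.1 z.1)
      rw [show (z.1, signedHeight i 0) = z from Prod.ext rfl ((signedHeight_zero i).trans h0.symm)]
        at ht
      filter_upwards [ht.eventually (hU.mem_nhds hzU)] with x hx
      exact (hin x).2 hx
    · cases hz.1

theorem isOpenEmbedding_chart (p : S) : IsOpenEmbedding (chart p) :=
  .of_continuous_injective_isOpenMap (continuous_chart p) (chart_injective p) (isOpenMap_chart p)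

/-- The domain of the chart at `p`: the union of the two half-spaces and of the rays at `p`. -/
def chartDomain (p : S) : Set (Manifold n S) := range (chart p)

theorem isOpen_chartDomain (p : S) : IsOpen (chartDomain p) := (isOpenEmbedding_chart p).isOpen_range

theorem inner_mem_chartDomain (p : S) (i : Bool) (x : HalfSpace n) :
    incl i (Bordered.inner x) ∈ chartDomain p := ⟨_, chart_slope p i x⟩

theorem ray_mem_chartDomain {p q : S} {i : Bool} {v : Hyperplane n} :
    incl i (Bordered.ray q v) ∈ chartDomain p ↔ q = p := by
  constructor
  · rintro ⟨z, hz⟩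
    rcases chart_cases p z with ⟨-, hz'⟩ | ⟨i, x, -, hz'⟩ <;> rw [hz', incl_eq_incl] at hz
    · exact (Bordered.ray.inj hz.1).1.symm
    · cases hz.1
  · rintro rfl
    exact ⟨_, chart_zero q i v⟩

/-- The open half-space in the copy with index `i`. -/
def half (S : Set (Hyperplane n)) (i : Bool) : Set (Manifold n S) :=
  range fun x => incl i (Bordered.inner x)

theorem isOpen_half (i : Bool) : IsOpen (half S i) := by
  refine isOpen_manifold.2 fun j => isOpen_bordered_iff.2 ⟨?_, fun p => ?_, ?_⟩
  · rcases eq_or_ne j i with rfl | h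
    · convert isOpen_univ
      exact eq_univ_of_forall fun x => ⟨x, rfl⟩
    · convert isOpen_empty
      refine eq_empty_of_forall_notMem ?_
      rintro x ⟨y, hy⟩
      obtain ⟨-, h' | ⟨_, _, h'⟩⟩ := incl_eq_incl.1 hy
      · exact h h'.symm
      · cases h'
  · convert isOpen_empty
    refine eq_empty_of_forall_notMem ?_
    rintro v ⟨y, hy⟩
    cases (incl_eq_incl.1 hy).1
  · rintro p v ⟨y, hy⟩
    cases (incl_eq_incl.1 hy).1

theorem inner_mem_half {i j : Bool} {x : HalfSpace n} :
    incl i (Bordered.inner x) ∈ half S j ↔ i = j := by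
  constructor
  · rintro ⟨y, hy⟩
    obtain ⟨-, h' | ⟨_, _, h'⟩⟩ := incl_eq_incl.1 hy
    · exact h'.symm
    · cases h'
  · rintro rfl
    exact ⟨x, rfl⟩

theorem half_subset_chartDomain (i : Bool) (p : S) : half S i ⊆ chartDomain p := by
  rintro _ ⟨x, rfl⟩
  exact inner_mem_chartDomain p i x

theorem eq_or_mem_half {p q : S} {x : Manifold n S} (hp : x ∈ chartDomain p)
    (hq : x ∈ chartDomain q) : p = q ∨ ∃ i, x ∈ half S i := by
  obtain ⟨i, b | ⟨r, v⟩, rfl⟩ := exists_incl x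
  · exact Or.inr ⟨i, b, rfl⟩
  · exact Or.inl ((ray_mem_chartDomain.1 hp).symm.trans (ray_mem_chartDomain.1 hq))

/-! ### Lifts of circle-valued maps -/

theorem lift_eq_add_of_preconnected {A : Type*} [TopologicalSpace A] [PreconnectedSpace A]
    [Nonempty A] {θ θ' : A → ℝ} (hθ : Continuous θ) (hθ' : Continuous θ')
    (h : ∀ a, Circle.exp (θ a) = Circle.exp (θ' a)) :
    ∃ m : ℤ, ∀ a, θ a = θ' a + m * (2 * Real.pi) := by
  obtain ⟨a₀⟩ := ‹Nonempty A›
  obtain ⟨m, hm⟩ := Circle.exp_eq_exp.1 (h a₀)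
  refine ⟨m, fun a => ?_⟩
  have := Circle.isCoveringMap_exp.eq_of_comp_eq (g₁ := θ)
    (g₂ := fun t => θ' t + m * (2 * Real.pi)) hθ (by fun_prop)
    (by
      funext t
      simp only [Function.comp_apply]
      rw [h t]
      exact (Circle.exp_eq_exp.2 ⟨m, rfl⟩).symm) a₀ hm
  exact congrFun this a

/-- The homotopy `(s, v) ↦ f (s • v)` starts at a constant map, whose constant lift is carried along
to `s = 1` by homotopy lifting. -/
theorem exists_lift_of_module {V : Type*} [AddCommGroup V] [Module ℝ V] [TopologicalSpace V]
    [ContinuousSMul ℝ V] {f : V → Circle} (hf : Continuous f) :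
    ∃ θ : V → ℝ, Continuous θ ∧ ∀ v, Circle.exp (θ v) = f v := by
  obtain ⟨e, he⟩ := Circle.exp_surjective (f 0)
  let H : C(I × V, Circle) := ⟨fun x => f ((x.1 : ℝ) • x.2), hf.comp (by fun_prop)⟩
  have H0 : ∀ v, H (0, v) = Circle.exp (ContinuousMap.const V e v) := fun v => by
    simp [H, he]
  refine ⟨fun v => Circle.isCoveringMap_exp.liftHomotopy H _ H0 (1, v), by fun_prop, fun v => ?_⟩
  have := congrFun (Circle.isCoveringMap_exp.liftHomotopy_lifts H _ H0) (1, v)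
  simpa [H] using this

theorem exists_lift_halfSpace {f : HalfSpace n → Circle} (hf : Continuous f) :
    ∃ θ : HalfSpace n → ℝ, Continuous θ ∧ ∀ x, Circle.exp (θ x) = f x := by
  obtain ⟨θ, hθ, h⟩ := exists_lift_of_module (V := Hyperplane n × ℝ)
    (f := fun z => f ⟨(z.1, Real.exp z.2), Real.exp_pos _⟩) (hf.comp (by fun_prop))
  refine ⟨fun x => θ (x.1.1, Real.log x.1.2), hθ.comp (Continuous.prodMk (by fun_prop)
    (Continuous.log (by fun_prop) fun x => x.2.ne')), fun x => (h _).trans ?_⟩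
  congr 1
  exact Subtype.ext (Prod.ext rfl (Real.exp_log x.2))

instance : Nonempty (HalfSpace n) := ⟨⟨(0, 1), one_pos⟩⟩

instance : PathConnectedSpace (HalfSpace n) :=
  isPathConnected_iff_pathConnectedSpace.1
    (((convex_Ioi (0 : ℝ)).is_linear_preimage (LinearMap.snd ℝ (Hyperplane n) ℝ).isLinear).isPathConnected
      ⟨(0, 1), (one_pos : (0 : ℝ) < 1)⟩)

/-- The half-space and every collar have lifts of their own. On the connected half-space each collar
lift differs from the given one by a constant in 2πℤ; once this is subtracted, the collar lift
supplies the boundary values at `p`. -/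
theorem exists_lift_bordered {f : Bordered n S → Circle} (hf : Continuous f) :
    ∃ θ : C(Bordered n S, ℝ), ∀ b, Circle.exp (θ b) = f b := by
  obtain ⟨θ, hθ, h⟩ := exists_lift_halfSpace (hf.comp continuous_inner)
  have key : ∀ p : S, ∃ ϑ : Hyperplane n × ℝ → ℝ, Continuous ϑ ∧
      (∀ z, Circle.exp (ϑ z) = f (collar p z)) ∧ ∀ x : HalfSpace n, ϑ (slope p.1 x, x.1.2) = θ x := by
    intro p
    obtain ⟨ϑ, hϑ, h'⟩ := exists_lift_of_module (hf.comp (continuous_collar p))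
    obtain ⟨m, hm⟩ := lift_eq_add_of_preconnected
      (θ := fun x : HalfSpace n => ϑ (slope p.1 x, x.1.2)) (θ' := θ)
      (hϑ.comp ((continuous_slope p.1).prodMk (by fun_prop))) hθ
      fun x => by rw [h', h, Function.comp_apply, collar_slope, Function.comp_apply]
    refine ⟨fun z => ϑ z - m * (2 * Real.pi), by fun_prop, fun z => ?_, fun x => ?_⟩
    · refine Eq.trans (Circle.exp_eq_exp.2 ⟨-m, ?_⟩) (h' z)
      push_cast
      ring
    · dsimp only
      rw [hm, add_sub_cancel_right]
  choose ϑ hϑ h₁ h₂ using key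
  let Θ : Bordered n S → ℝ := fun b => match b with
    | .inner x => θ x
    | .ray p v => ϑ p (v, 0)
  refine ⟨⟨Θ, continuous_bordered hθ (fun p => (hϑ p).comp (by fun_prop)) fun p v => ?_⟩, ?_⟩
  · have hc : Continuous fun z : (Hyperplane n × ℝ) × Hyperplane n => ϑ p (z.2, z.1.2) :=
      (hϑ p).comp (by fun_prop)
    exact ((hc.tendsto _).comp (tendsto_tangentialFilter p.1 v)).congr fun x => h₂ p x
  · rintro (x | ⟨p, v⟩)
    · exact h x
    · exact (h₁ p (v, 0)).trans (by rw [collar_of_nonpos p le_rfl])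

/-- The winding number of a circle-valued map along `α_{p,q}` in terms of lifts of its
restrictions to the two copies of the bordered Prüfer manifold. -/
theorem windingNumber_loop (f : C(Manifold n S, Circle)) (θ : Bool → C(Bordered n S, ℝ))
    (h : ∀ i b, Circle.exp (θ i b) = f (incl i b)) (p q : S) :
    (windingNumber (f.comp (loop p q).toContinuousMap) : ℝ) * (2 * Real.pi) =
      (θ true (.ray q 0) - θ false (.ray q 0)) - (θ true (.ray p 0) - θ false (.ray p 0)) := by
  have e : ∀ r : S, Circle.exp (θ true (.ray r 0)) = Circle.exp (θ false (.ray r 0)) := fun r => by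
    rw [h, h, incl_ray true false]
  obtain ⟨m, hm⟩ := Circle.exp_eq_exp.1 (e q)
  let P : Path (θ true (.ray p 0)) (θ true (.ray q 0)) := (arc p q).map (θ true).continuous
  -- The shift by `m` makes the lift over the second copy start where the lift over the first arc
  -- ends.
  let P' : Path (θ true (.ray q 0)) (θ false (.ray p 0) + m * (2 * Real.pi)) :=
    ((arc p q).symm.map ((θ false).continuous.add continuous_const :
      Continuous fun b => θ false b + m * (2 * Real.pi))).cast hm rfl
  have hl : (f.comp (loop p q).toContinuousMap) 0 = (f.comp (loop p q).toContinuousMap) 1 :=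
    congrArg f ((loop p q).source.trans (loop p q).target.symm)
  have := windingNumber_spec _ hl (P.trans P').toContinuousMap fun t => by
    change Circle.exp ((P.trans P') t) = f (loop p q t)
    rw [show loop p q t = _ from Path.trans_apply _ _ _, Path.trans_apply]
    split_ifs with ht
    · exact h true _
    · refine Eq.trans ?_ (h false _)
      exact Circle.exp_eq_exp.2 ⟨m, rfl⟩
  rw [← this]
  change (P.trans P') 1 - (P.trans P') 0 = _
  rw [Path.target, Path.source]
  linarith

/-! ### Injectivity of the comparison morphism -/

/-- The rays at one base point form a connected set, so the two lifts differ there by a constant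
multiple of 2π. Vanishing winding numbers make this multiple independent of the base point, and a
single shift then glues the lifts. -/
theorem exists_lift_of_windingNumber_eq_zero (p₀ : S) (f : C(Manifold n S, Circle))
    (h : ∀ p, windingNumber (f.comp (loop p₀ p).toContinuousMap) = 0) :
    ∃ Θ : C(Manifold n S, ℝ), ∀ x, Circle.exp (Θ x) = f x := by
  choose θ hθ using fun i => exists_lift_bordered (f.continuous.comp (continuous_incl (S := S) i))
  have hw := fun p => windingNumber_loop f θ hθ p₀ p
  have hray : ∀ p : S, ∃ m : ℤ, ∀ v : Hyperplane n,
      θ true (.ray p v) = θ false (.ray p v) + m * (2 * Real.pi) := fun p =>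
    lift_eq_add_of_preconnected ((θ true).continuous.comp (continuous_ray p))
      ((θ false).continuous.comp (continuous_ray p)) fun v => by
        simp only [Function.comp_apply, hθ, incl_ray true false]
  obtain ⟨m₀, hm₀⟩ := hray p₀
  have hray' : ∀ (p : S) (v : Hyperplane n),
      θ true (.ray p v) = θ false (.ray p v) + m₀ * (2 * Real.pi) := by
    intro p v
    obtain ⟨m, hm⟩ := hray p
    have := hw p
    rw [h p, hm 0, hm₀ 0] at this
    rw [hm v]
    simp only [Int.cast_zero, zero_mul] at this
    linarith
  let Θ : Bool × Bordered n S → ℝ := fun x =>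
    if x.1 then θ true x.2 else θ false x.2 + m₀ * (2 * Real.pi)
  have hΘ : ∀ a b, (doubleSetoid n S).r a b → Θ a = Θ b := by
    rintro ⟨i, a⟩ ⟨j, b⟩ ⟨hab, h'⟩
    dsimp only at hab h'
    subst hab
    rcases h' with rfl | ⟨p, v, rfl⟩
    · rfl
    · cases i <;> cases j <;> simp [Θ, hray']
  refine ⟨⟨fun x => Quotient.lift Θ hΘ x, continuous_manifold fun i => ?_⟩, fun x => ?_⟩
  · cases i
    · exact (θ false).continuous.add continuous_const
    · exact (θ true).continuous
  · obtain ⟨i, b, rfl⟩ := exists_incl x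
    cases i
    · exact Eq.trans (Circle.exp_eq_exp.2 ⟨m₀, rfl⟩) (hθ false b)
    · exact hθ true b

theorem homotopic_one_of_lift {X : Type*} [TopologicalSpace X] {f : C(X, Circle)} {Θ : C(X, ℝ)}
    (h : ∀ x, Circle.exp (Θ x) = f x) : f.Homotopic 1 :=
  ⟨{ toFun := fun x => Circle.exp ((1 - (x.1 : ℝ)) * Θ x.2)
     continuous_toFun := by fun_prop
     map_zero_left := fun x => by simp [h]
     map_one_left := fun x => by simp }⟩

theorem comparison_injective (p₀ : S) :
    Function.Injective (comparison (Manifold n S) (verticalRay p₀)) := by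
  refine (injective_iff_map_eq_one _).2 fun a ha => ?_
  induction a using Con.induction_on with | H f => ?_
  obtain ⟨Θ, hΘ⟩ := exists_lift_of_windingNumber_eq_zero p₀ f fun p =>
    congrArg Multiplicative.toAdd (DFunLike.congr_fun ha (loopClass p₀ p))
  exact (Con.eq _).2 (homotopic_one_of_lift hΘ)

/-! ### The image of the comparison morphism consists of Baire-1 functions -/

theorem isBaireOne_of_tendsto {X : Type*} [TopologicalSpace X] {f : X → ℤ} {g : ℕ → X → ℝ}
    (hg : ∀ j, Continuous (g j)) (h : ∀ x, Tendsto (fun j => g j x) atTop (𝓝 (f x))) :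
    IsBaireOne f := by
  intro U _
  have hm : ∀ m : ℤ, IsFsigma (f ⁻¹' {m}) := by
    -- Any constant strictly between 0 and 1 would do: it must be positive for convergence to force
    -- the bound, and less than 1 for the bound to identify the integer limit.
    refine fun m => ⟨fun k => ⋂ j ≥ k, {x | |g j x - m| ≤ 1 / 3}, fun k =>
      isClosed_biInter fun j _ => isClosed_le (by have := hg j; fun_prop) continuous_const, ?_⟩
    ext x
    simp only [mem_preimage, mem_singleton_iff, mem_iUnion, mem_iInter, mem_ofPred_eq]
    have hx : Tendsto (fun j => |g j x - m|) atTop (𝓝 |(f x : ℝ) - m|) :=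
      ((h x).sub_const _).abs
    constructor
    · rintro rfl
      rw [sub_self, abs_zero] at hx
      exact eventually_atTop.1 (hx.eventually (eventually_le_nhds (by norm_num)))
    · rintro ⟨k, hk⟩
      have := le_of_tendsto hx (eventually_atTop.2 ⟨k, hk⟩)
      have h1 : |(f x : ℝ) - m| < 1 := by linarith
      rw [← Int.cast_sub, ← Int.cast_abs, ← Int.cast_one, Int.cast_lt, Int.abs_lt_one_iff] at h1
      exact sub_eq_zero.1 h1
  have : f ⁻¹' U = ⋃ m : U, f ⁻¹' {m.1} := by
    ext x
    simp
  rw [this]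
  exact IsFsigma.iUnion fun m => hm m

theorem tendsto_vertical (θ : C(Bordered n S, ℝ)) (p : S) :
    Tendsto (fun j : ℕ => θ (.inner ⟨(p.1, 1 / ((j : ℝ) + 1)), Nat.one_div_pos_of_nat⟩)) atTop
      (𝓝 (θ (.ray p 0))) := by
  have hc : Tendsto (fun j : ℕ => collar p (0, 1 / ((j : ℝ) + 1))) atTop (𝓝 (collar p (0, 0))) :=
    ((continuous_collar p).tendsto _).comp
      (tendsto_const_nhds.prodMk_nhds tendsto_one_div_add_atTop_nhds_zero_nat)
  rw [collar_of_nonpos p le_rfl] at hc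
  refine ((θ.continuous.tendsto _).comp hc).congr fun j => ?_
  rw [Function.comp_apply, collar_of_pos p (z := (0, 1 / ((j : ℝ) + 1))) Nat.one_div_pos_of_nat]
  simp

/-- The vertical ray at `p` need not depend continuously on `p`, but the point at fixed height above
`p` does. Approaching the boundary vertically thus exhibits the winding numbers as a pointwise limit
of continuous functions. -/
theorem isBaireOne_windingNumber (p₀ : S) (f : C(Manifold n S, Circle)) :
    IsBaireOne fun p : Punctured p₀ => windingNumber (f.comp (loop p₀ p.1).toContinuousMap) := by
  choose θ hθ using fun i => exists_lift_bordered (f.continuous.comp (continuous_incl (S := S) i))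
  set c := θ true (.ray p₀ 0) - θ false (.ray p₀ 0) with hc
  let x : ℕ → Punctured p₀ → HalfSpace n := fun j p =>
    ⟨(p.1.1, 1 / ((j : ℝ) + 1)), Nat.one_div_pos_of_nat⟩
  have hx : ∀ j i, Continuous fun p => θ i (.inner (x j p)) := fun j i =>
    (θ i).continuous.comp (continuous_inner.comp (by fun_prop))
  refine isBaireOne_of_tendsto
    (g := fun j p => (θ true (.inner (x j p)) - θ false (.inner (x j p)) - c) / (2 * Real.pi))
    (fun j => (((hx j true).sub (hx j false)).sub continuous_const).div_const _) fun p => ?_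
  have hpi : (2 * Real.pi) ≠ 0 := by positivity
  rw [eq_div_of_mul_eq hpi (windingNumber_loop f θ hθ p₀ p.1)]
  exact (((tendsto_vertical (θ true) p.1).sub (tendsto_vertical (θ false) p.1)).sub_const c).div_const _

/-! ### Functions on the half-space with prescribed non-tangential limits -/

/-- A function on the half-space with values in `[0,1]` that vanishes at heights at least `2 / c`,
and whose limits along rays are `1` over `A` and `0` off the closure of `A`. -/
def weight (A : Set (Hyperplane n)) (c : ℝ) (x : HalfSpace n) : ℝ :=
  max 0 (min 1 (2 - c * x.1.2 - Metric.infDist x.1.1 A / √x.1.2))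

theorem continuous_weight (A : Set (Hyperplane n)) (c : ℝ) : Continuous (weight A c) := by
  unfold weight
  refine continuous_const.max (continuous_const.min (Continuous.sub (by fun_prop) ?_))
  exact ((Metric.continuous_infDist_pt A).comp (by fun_prop)).div (by fun_prop)
    fun x => (Real.sqrt_pos.2 x.2).ne'

theorem weight_eq_zero {A : Set (Hyperplane n)} {c : ℝ} {x : HalfSpace n} (h : 2 ≤ c * x.1.2) :
    weight A c x = 0 := by
  have : 0 ≤ Metric.infDist x.1.1 A / √x.1.2 := by
    have := Metric.infDist_nonneg (x := x.1.1) (s := A)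
    positivity
  exact max_eq_left ((min_le_right _ _).trans (by linarith))

theorem tendsto_height (p v : Hyperplane n) :
    Tendsto (fun x : HalfSpace n => x.1.2) (tangentialFilter p v) (𝓝 0) :=
  ((continuous_snd.comp continuous_fst).tendsto ((p, (0 : ℝ)), v)).comp (tendsto_tangentialFilter p v)

theorem tendsto_foot (p v : Hyperplane n) :
    Tendsto (fun x : HalfSpace n => x.1.1) (tangentialFilter p v) (𝓝 p) :=
  ((continuous_fst.comp continuous_fst).tendsto ((p, (0 : ℝ)), v)).comp (tendsto_tangentialFilter p v)

theorem tendsto_slope (p v : Hyperplane n) :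
    Tendsto (slope p) (tangentialFilter p v) (𝓝 v) :=
  (continuous_snd.tendsto ((p, (0 : ℝ)), v)).comp (tendsto_tangentialFilter p v)

/-- The distance to `A` is at most height times the norm of the slope, which is negligible against
the square root of the height. The inner expression of `weight` is therefore bounded below by a
quantity tending to 2, and the truncation at 1 is reached. -/
theorem eventually_weight_eq_one {A : Set (Hyperplane n)} (c : ℝ) {p : Hyperplane n} (hp : p ∈ A)
    (v : Hyperplane n) : ∀ᶠ x in tangentialFilter p v, weight A c x = 1 := by
  have ht := tendsto_height p v
  have h : Tendsto (fun x : HalfSpace n => 2 - c * x.1.2 - √x.1.2 * ‖slope p x‖)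
      (tangentialFilter p v) (𝓝 2) := by
    simpa using (tendsto_const_nhds.sub (ht.const_mul c)).sub
      (((Real.continuous_sqrt.tendsto 0).comp ht).mul (tendsto_slope p v).norm)
  filter_upwards [h.eventually (eventually_ge_nhds one_lt_two)] with x hx
  have hd : Metric.infDist x.1.1 A / √x.1.2 ≤ √x.1.2 * ‖slope p x‖ := by
    have h1 := Metric.infDist_le_dist_of_mem hp (x := x.1.1)
    have h2 : dist x.1.1 p = x.1.2 * ‖slope p x‖ := by
      rw [slope, norm_smul, norm_inv, Real.norm_of_nonneg x.2.le, mul_inv_cancel_left₀ x.2.ne',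
        dist_eq_norm]
    rw [div_le_iff₀ (Real.sqrt_pos.2 x.2), mul_right_comm, Real.mul_self_sqrt x.2.le, ← h2]
    exact h1
  rw [weight, min_eq_left (by linarith), max_eq_right zero_le_one]

/-- The distance to `A` stays away from 0 while the square root of the height tends to 0.
Non-emptiness is essential, as `Metric.infDist` to the empty set is 0 by convention. -/
theorem eventually_weight_eq_zero {A : Set (Hyperplane n)} (hA : A.Nonempty) {c : ℝ} (hc : 0 ≤ c)
    {p : Hyperplane n} (hp : p ∉ closure A) (v : Hyperplane n) :
    ∀ᶠ x in tangentialFilter p v, weight A c x = 0 := by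
  have hpos : 0 < Metric.infDist p A := (Metric.infDist_pos_iff_notMem_closure hA).1 hp
  have h : Tendsto (fun x : HalfSpace n => Metric.infDist x.1.1 A - 2 * √x.1.2)
      (tangentialFilter p v) (𝓝 (Metric.infDist p A)) := by
    simpa using (((Metric.continuous_infDist_pt A).tendsto p).comp (tendsto_foot p v)).sub
      (((Real.continuous_sqrt.tendsto 0).comp (tendsto_height p v)).const_mul 2)
  filter_upwards [h.eventually (eventually_gt_nhds hpos)] with x hx
  have hd : 2 ≤ Metric.infDist x.1.1 A / √x.1.2 := by
    rw [le_div_iff₀ (Real.sqrt_pos.2 x.2)]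
    linarith
  have : 0 ≤ c * x.1.2 := mul_nonneg hc x.2.le
  exact max_eq_left ((min_le_right _ _).trans (by linarith))

/-- A continuous function on the half-space whose limit along the rays at `p` is `m i`, for the
least index `i` with `p ∈ A i`. -/
def blend (A : ℕ → Set (Hyperplane n)) (m : ℕ → ℤ) (x : HalfSpace n) : ℝ :=
  ∑ᶠ i : ℕ, m i * weight (A i) (i + 1) x * ∏ j ∈ Finset.range i, (1 - weight (A j) (j + 1) x)

theorem continuous_blend (A : ℕ → Set (Hyperplane n)) (m : ℕ → ℤ) : Continuous (blend A m) := by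
  refine continuous_finsum (fun i => ?_) fun x => ?_
  · exact (continuous_const.mul (continuous_weight _ _)).mul
      (continuous_finsetProd _ fun j _ => continuous_const.sub (continuous_weight _ _))
  · refine ⟨{y | x.1.2 / 2 < y.1.2}, (isOpen_lt continuous_const (by fun_prop)).mem_nhds
      (half_lt_self x.2), ?_⟩
    -- Local finiteness: at heights above half that of `x`, the index `i ≥ N` gives `(i + 1) * y.1.2
    -- > 2`, so the weight vanishes.
    obtain ⟨N, hN⟩ := exists_nat_gt (4 / x.1.2)
    refine (finite_lt_nat N).subset ?_
    rintro i ⟨y, hy, hyx⟩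
    by_contra hi
    have hi : (N : ℝ) ≤ i := by exact_mod_cast not_lt.1 hi
    have hx : 0 < x.1.2 := x.2
    have hyx : x.1.2 / 2 < y.1.2 := hyx
    have h4 : 4 < i * x.1.2 := (div_lt_iff₀ hx).1 (hN.trans_le hi)
    refine hy ?_
    dsimp only
    rw [weight_eq_zero (by nlinarith), mul_zero, zero_mul]

/-- Smaller indices have weight 0 and index `i` has weight 1. Every later term contains the factor
`1 - 1`, so only finitely many weights need control near the ray. -/
theorem eventually_blend_eq {A : ℕ → Set (Hyperplane n)} (hA : ∀ i, (A i).Nonempty) (m : ℕ → ℤ)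
    {p : Hyperplane n} {i : ℕ} (hi : p ∈ A i) (hlt : ∀ j < i, p ∉ closure (A j))
    (v : Hyperplane n) : ∀ᶠ x in tangentialFilter p v, blend A m x = m i := by
  have h : ∀ᶠ x in tangentialFilter p v, ∀ j ∈ Finset.range i, weight (A j) (j + 1) x = 0 :=
    (Finset.eventually_all _).2 fun j hj =>
      eventually_weight_eq_zero (hA j) (by positivity) (hlt j (Finset.mem_range.1 hj)) v
  filter_upwards [h, eventually_weight_eq_one (i + 1) hi v] with x h0 h1
  rw [blend, finsum_eq_single _ i]
  · rw [h1, Finset.prod_eq_one fun j hj => by rw [h0 j hj, sub_zero], mul_one, mul_one]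
  · intro j hj
    rcases hj.lt_or_gt with hj | hj
    · rw [h0 j (Finset.mem_range.2 hj), mul_zero, zero_mul]
    · rw [Finset.prod_eq_zero (Finset.mem_range.2 hj) (by rw [h1, sub_self]), mul_zero]

/-! ### Every Baire-1 function is in the image of the comparison morphism -/

/-- A function `k : S → ℤ` whose values are the limits along rays of a continuous function on the
half-space that is eventually constant along them gives the winding numbers of a circle-valued
map. -/
theorem exists_map_of_limits (p₀ : S) (k : S → ℤ) (h₀ : k p₀ = 0) (g : HalfSpace n → ℝ)
    (hg : Continuous g)
    (h : ∀ (p : S) v, ∀ᶠ x in tangentialFilter p.1 v, g x = k p) :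
    ∃ f : C(Manifold n S, Circle), ∀ p,
      windingNumber (f.comp (loop p₀ p).toContinuousMap) = k p := by
  let G : Bordered n S → ℝ := fun b => match b with
    | .inner x => 2 * Real.pi * g x
    | .ray p _ => 2 * Real.pi * k p
  have hG : Continuous G := by
    refine continuous_bordered (continuous_const.mul hg) (fun p => continuous_const) fun p v => ?_
    refine tendsto_const_nhds.congr' ?_
    filter_upwards [h p v] with x hx
    change 2 * Real.pi * (k p : ℝ) = 2 * Real.pi * g x
    rw [hx]
  -- The lifts disagree on the rays by 2π times an integer, so their exponentials glue.
  let θ : Bool → C(Bordered n S, ℝ) := fun i => if i then ⟨G, hG⟩ else 0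
  let F : Bool × Bordered n S → Circle := fun x => Circle.exp (θ x.1 x.2)
  have hray : ∀ (i : Bool) (p : S) v, Circle.exp (θ i (.ray p v)) = 1 := by
    rintro (i | i) p v
    · simp [θ]
    · refine Circle.exp_eq_one.2 ⟨k p, ?_⟩
      simp [θ, G, mul_comm]
  have hF : ∀ a b, (doubleSetoid n S).r a b → F a = F b := by
    rintro ⟨i, a⟩ ⟨j, b⟩ ⟨hab, h'⟩
    dsimp only at hab h'
    subst hab
    rcases h' with rfl | ⟨p, v, rfl⟩
    · rfl
    · simp only [F, hray]
  let f : C(Manifold n S, Circle) := ⟨fun x => Quotient.lift F hF x, continuous_manifold fun i =>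
    Circle.exp.continuous.comp (θ i).continuous⟩
  refine ⟨f, fun p => ?_⟩
  have hw := windingNumber_loop f θ (fun i b => rfl) p₀ p
  have e : ∀ p, θ true (.ray p 0) - θ false (.ray p 0) = k p * (2 * Real.pi) := fun p => by
    simp [θ, G, mul_comm]
  rw [e, e, h₀, Int.cast_zero, zero_mul, sub_zero] at hw
  have hpi : (2 * Real.pi) ≠ 0 := by positivity
  exact_mod_cast mul_right_cancel₀ hpi hw

theorem exists_map_of_isBaireOne (p₀ : S) {k : Punctured p₀ → ℤ} (hk : IsBaireOne k) :
    ∃ f : C(Manifold n S, Circle), ∀ p : Punctured p₀,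
      windingNumber (f.comp (loop p₀ p.1).toContinuousMap) = k p := by
  classical
  choose F hFc hF using fun m : ℤ => hk {m} (isOpen_discrete _)
  obtain ⟨e, he⟩ := exists_surjective_nat (ℤ × ℕ)
  have hind : IsInducing fun p : Punctured p₀ => p.1.1 :=
    IsInducing.subtypeVal.comp IsInducing.subtypeVal
  let C : ℕ → Set (Hyperplane n) := fun i => (fun p : Punctured p₀ => p.1.1) '' F (e i).1 (e i).2
  -- Index 0 is reserved for `p₀` with value 0, so closures of later pieces may contain `p₀`
  -- harmlessly. Empty pieces are replaced by `{p₀}` because the weights need non-empty sets; no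
  -- other point lies in that closed set.
  let A : ℕ → Set (Hyperplane n) := fun i =>
    i.casesOn {p₀.1} fun i => if (C i).Nonempty then C i else {p₀.1}
  let m : ℕ → ℤ := fun i => i.casesOn 0 fun i => if (C i).Nonempty then (e i).1 else 0
  have hA : ∀ i, A i = {p₀.1} ∨ ∃ j, A i = C j ∧ m i = (e j).1 := by
    rintro (_ | i)
    · exact Or.inl rfl
    · by_cases h : (C i).Nonempty
      · exact Or.inr ⟨i, if_pos h, if_pos h⟩
      · exact Or.inl (if_neg h)
  have hne : ∀ i, (A i).Nonempty := by
    rintro (_ | i)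
    · exact singleton_nonempty _
    · by_cases h : (C i).Nonempty
      · simp [A, h]
      · simp [A, h]
  let K : S → ℤ := fun p => if h : p ≠ p₀ then k ⟨p, h⟩ else 0
  have hlim : ∀ p : S, ∃ i, p.1 ∈ A i ∧ (∀ j < i, p.1 ∉ closure (A j)) ∧ m i = K p := by
    intro p
    by_cases hp : p = p₀
    · subst hp
      exact ⟨0, rfl, fun j hj => absurd hj j.not_lt_zero, by simp [m, K]⟩
    have hp1 : p.1 ≠ p₀.1 := fun h => hp (Subtype.ext h)
    have hmemC : ∀ j, p.1 ∈ C j ↔ (⟨p, hp⟩ : Punctured p₀) ∈ F (e j).1 (e j).2 := by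
      refine fun j => ⟨?_, fun h => ⟨_, h, rfl⟩⟩
      rintro ⟨q, hq, hqp⟩
      have : q = ⟨p, hp⟩ := Subtype.ext (Subtype.ext hqp)
      rwa [this] at hq
    have hex : ∃ i, p.1 ∈ A i := by
      have : (⟨p, hp⟩ : Punctured p₀) ∈ k ⁻¹' {k ⟨p, hp⟩} := rfl
      rw [hF, mem_iUnion] at this
      obtain ⟨l, hl⟩ := this
      obtain ⟨j, hj⟩ := he (k ⟨p, hp⟩, l)
      have hj' : p.1 ∈ C j := (hmemC j).2 (by rw [hj]; exact hl)
      refine ⟨j + 1, ?_⟩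
      change p.1 ∈ if (C j).Nonempty then C j else {p₀.1}
      rwa [if_pos ⟨_, hj'⟩]
    obtain ⟨l, hl, hmin⟩ : ∃ l, p.1 ∈ A l ∧ ∀ j < l, p.1 ∉ A j := by
      have := Classical.decPred fun i => p.1 ∈ A i
      exact ⟨Nat.find hex, Nat.find_spec hex, fun j hj => Nat.find_min hex hj⟩
    -- Minimality only excludes `A j`. Its closure in the hyperplane is excluded too, since the
    -- pieces are closed in the punctured set, which carries the induced topology.
    refine ⟨l, hl, fun j hj hcl => hmin j hj ?_, ?_⟩
    · rcases hA j with h | ⟨i, h, -⟩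
      · rw [h, isClosed_singleton.closure_eq] at hcl
        exact absurd hcl hp1
      · rw [h] at hcl ⊢
        rw [hmemC, ← (hFc _ _).closure_eq, hind.closure_eq_preimage_closure_image]
        exact hcl
    · rcases hA l with h | ⟨i, h, hm⟩
      · rw [h] at hl
        exact absurd hl hp1
      · rw [h, hmemC] at hl
        have : (⟨p, hp⟩ : Punctured p₀) ∈ k ⁻¹' {(e i).1} := by
          rw [hF, mem_iUnion]
          exact ⟨_, hl⟩
        rw [hm, ← mem_singleton_iff.1 this]
        simp [K, hp]
  obtain ⟨f, hf⟩ := exists_map_of_limits p₀ K (by simp [K]) (blend A m) (continuous_blend A m)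
    fun p v => by
      obtain ⟨i, hi, hlt, hm⟩ := hlim p
      rw [← hm]
      exact eventually_blend_eq hne m hi hlt v
  exact ⟨f, fun p => (hf p.1).trans (by simp [K, p.2])⟩

theorem range_comparison (p₀ : S) :
    ((evalOnLoops p₀).comp (comparison (Manifold n S) (verticalRay p₀)).toAdditive).range =
      baireOneSubgroup (Punctured p₀) := by
  ext k
  constructor
  · rintro ⟨a, rfl⟩
    induction a using Con.induction_on with | H f => ?_
    exact isBaireOne_windingNumber p₀ f
  · intro hk
    obtain ⟨f, hf⟩ := exists_map_of_isBaireOne p₀ hk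
    exact ⟨Additive.ofMul (f : (homotopyCon (Manifold n S)).Quotient), funext hf⟩

section Coverings

/-! ### Coverings of the Prüfer manifold -/

/-- The base point of the ray at the given point of the Prüfer manifold, or `p₀` if that point lies
in an open half-space. -/
def foot (p₀ : S) (x : Manifold n S) : S :=
  open Classical in if h : ∃ p v, x = incl true (Bordered.ray p v) then h.choose else p₀

theorem foot_ray (p₀ : S) (i : Bool) (p : S) (v : Hyperplane n) :
    foot p₀ (incl i (Bordered.ray p v)) = p := by
  have h : ∃ q w, incl i (Bordered.ray p v) = incl true (Bordered.ray q w) :=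
    ⟨p, v, incl_ray i true p v⟩
  rw [foot, dif_pos h]
  obtain ⟨w, hw⟩ := h.choose_spec
  exact (Bordered.ray.inj (incl_eq_incl.1 hw).1).1.symm

theorem mem_chartDomain_foot (p₀ : S) (x : Manifold n S) : x ∈ chartDomain (foot p₀ x) := by
  obtain ⟨i, b | ⟨r, v⟩, rfl⟩ := exists_incl x
  · exact inner_mem_chartDomain _ i b
  · exact ray_mem_chartDomain.2 (foot_ray p₀ i r v).symm

theorem foot_eq_or_mem_half (p₀ : S) {p : S} {x : Manifold n S} (hp : x ∈ chartDomain p) :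
    foot p₀ x = p ∨ ∃ i, x ∈ half S i :=
  eq_or_mem_half (mem_chartDomain_foot p₀ x) hp

variable {G : Type*} [Group G]

/-- The change of trivialisations of the principal bundle with constant transition functions given
by `k` on the second open half-space. -/
def transition (k : S → G) (p q : S) (x : Manifold n S) (g : G) : G :=
  open Classical in if x ∈ half S false then g * (k p)⁻¹ * k q else g

theorem transition_of_mem (k : S → G) (p q : S) {x : Manifold n S} (h : x ∈ half S false) (g : G) :
    transition k p q x g = g * (k p)⁻¹ * k q := if_pos h

theorem transition_of_notMem (k : S → G) (p q : S) {x : Manifold n S} (h : x ∉ half S false)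
    (g : G) : transition k p q x g = g := if_neg h

theorem half_disjoint {x : Manifold n S} (h : x ∈ half S true) : x ∉ half S false := by
  obtain ⟨y, rfl⟩ := h
  simp [inner_mem_half]

theorem transition_self (k : S → G) (p : S) (x : Manifold n S) (g : G) :
    transition k p p x g = g := by
  unfold transition
  split_ifs <;> simp

variable [TopologicalSpace G] [DiscreteTopology G]

/-- The principal bundle over the Prüfer manifold, with discrete structure group, that is trivial
over each chart domain and has constant transition functions given by `k`. -/
def bundle (p₀ : S) (k : S → G) : FiberBundleCore S (Manifold n S) G where
  baseSet := chartDomain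
  isOpen_baseSet := isOpen_chartDomain
  indexAt := foot p₀
  mem_baseSet_at := mem_chartDomain_foot p₀
  coordChange := transition k
  coordChange_self p x _ g := transition_self k p x g
  continuousOn_coordChange p q := by
    rintro ⟨x, g⟩ ⟨⟨hp, hq⟩, -⟩
    refine ContinuousAt.continuousWithinAt ?_
    -- Either the charts coincide, or the point lies in an open half-space, throughout which the
    -- transition is the same map.
    rcases eq_or_mem_half hp hq with rfl | ⟨i, hi⟩
    · simp only [transition_self]
      exact continuousAt_snd
    · have hev : ∀ᶠ y : Manifold n S × G in 𝓝 (x, g), y.1 ∈ half S i :=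
        continuousAt_fst.eventually ((isOpen_half i).mem_nhds hi)
      cases i
      · refine ContinuousAt.congr (f := fun y : Manifold n S × G => y.2 * (k p)⁻¹ * k q) ?_ ?_
        · exact (continuous_of_discreteTopology (f := fun g : G => g * (k p)⁻¹ * k q)).continuousAt.comp
            continuousAt_snd
        · filter_upwards [hev] with y hy
          rw [transition_of_mem k p q hy]
      · refine continuousAt_snd.congr ?_
        filter_upwards [hev] with y hy
        rw [transition_of_notMem k p q (half_disjoint hy)]
  coordChange_comp p q r x _ g := by
    unfold transition
    split_ifs <;> group

theorem isCoveringMap_bundle (p₀ : S) (k : S → G) : IsCoveringMap (bundle p₀ k).proj :=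
  FiberBundle.isCoveringMap

/-- The flat sections of the bundle over the two copies of the bordered Prüfer manifold. -/
def flatSection (p₀ : S) (k : S → G) (i : Bool) (g : G) (b : Bordered n S) :
    (bundle p₀ k).TotalSpace :=
  ⟨incl i b, if i then g else g * k (foot p₀ (incl i b))⟩

/-- Read in a fixed trivialisation, the section is locally constant: on the second half-space the
transition from `p` to `q` turns `g * k p` into `g * k q`. -/
theorem continuous_flatSection (p₀ : S) (k : S → G) (i : Bool) (g : G) :
    Continuous (flatSection p₀ k i g) := by
  refine continuous_iff_continuousAt.2 fun b => ?_
  refine (FiberBundle.continuousAt_totalSpace G (flatSection p₀ k i g)).2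
    ⟨(continuous_incl i).continuousAt, ?_⟩
  have hev : ∀ᶠ c in 𝓝 b, incl i c ∈ chartDomain (foot p₀ (incl i b)) :=
    (continuous_incl i).continuousAt.eventually
      ((isOpen_chartDomain _).mem_nhds (mem_chartDomain_foot p₀ _))
  refine ContinuousAt.congr
    (f := fun _ => if i then g else g * k (foot p₀ (incl i b))) continuousAt_const ?_
  filter_upwards [hev] with c hc
  change _ = transition k (foot p₀ (incl i c)) (foot p₀ (incl i b)) (incl i c)
    (if i then g else g * k (foot p₀ (incl i c)))
  rcases foot_eq_or_mem_half p₀ hc with h | ⟨j, h⟩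
  · rw [h, transition_self]
  · obtain ⟨x, hx⟩ := h
    obtain ⟨rfl, -⟩ := incl_eq_incl.1 hx
    cases i
    · rw [transition_of_mem k _ _ (inner_mem_half.2 rfl)]
      simp
    · rw [transition_of_notMem k _ _ (half_disjoint (inner_mem_half.2 rfl))]
      simp

/-- The point over the vertical ray at `p₀` with the given coordinate. -/
def fibrePoint (p₀ : S) (k : S → G) (g : G) : (bundle p₀ k).proj ⁻¹' {verticalRay p₀} :=
  ⟨⟨verticalRay p₀, g⟩, rfl⟩

theorem fibrePoint_injective (p₀ : S) (k : S → G) : Function.Injective (fibrePoint p₀ k) := by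
  intro g h e
  injection congrArg Subtype.val e

theorem flatSection_ray (p₀ : S) (k : S → G) (i : Bool) (g : G) (p : S) (v : Hyperplane n) :
    flatSection p₀ k i g (.ray p v) =
      (⟨incl true (.ray p v), if i then g else g * k p⟩ : (bundle p₀ k).TotalSpace) := by
  rw [flatSection, foot_ray]
  exact congrArg (fun x => (⟨x, _⟩ : (bundle p₀ k).TotalSpace)) (incl_ray i true p v)

/-- The loop lifts along two flat sections. The one over the first copy reaches the ray at `p` with
coordinate `g`; the one over the second copy with that coordinate there has parameter `g * (k p)⁻¹`,
and ends over `p₀` at `g * (k p)⁻¹ * k p₀`. -/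
theorem monodromy_loopClass (p₀ : S) (k : S → G) (p : S) (g : G) :
    (isCoveringMap_bundle p₀ k).monodromyPerm (verticalRay p₀) (loopClass p₀ p)
      (fibrePoint p₀ k g) = fibrePoint p₀ k (g * (k p)⁻¹ * k p₀) := by
  have e : flatSection p₀ k false (g * (k p)⁻¹) (.ray p 0) = flatSection p₀ k true g (.ray p 0) := by
    rw [flatSection_ray, flatSection_ray]
    simp
  let P : Path (fibrePoint p₀ k g).1 (flatSection p₀ k true g (.ray p 0)) :=
    ((arc p₀ p).map (continuous_flatSection p₀ k true g)).cast (flatSection_ray p₀ k true g p₀ 0).symm rfl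
  let P' : Path (flatSection p₀ k true g (.ray p 0)) (fibrePoint p₀ k (g * (k p)⁻¹ * k p₀)).1 :=
    ((arc p₀ p).map (continuous_flatSection p₀ k false (g * (k p)⁻¹))).symm.cast e.symm
      (flatSection_ray p₀ k false _ p₀ 0).symm
  change (isCoveringMap_bundle p₀ k).monodromy (Path.Homotopic.Quotient.mk (loop p₀ p))
    (fibrePoint p₀ k g) = _
  refine (isCoveringMap_bundle p₀ k).monodromy_eq_of_map_eq
    (Path.Homotopic.Quotient.mk (P.trans P')) ?_
  change Path.Homotopic.Quotient.mk _ = Path.Homotopic.Quotient.mk _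
  congr 1
  ext t
  change (bundle p₀ k).proj ((P.trans P') t) = loop p₀ p t
  rw [show loop p₀ p t = _ from Path.trans_apply _ _ _, Path.trans_apply]
  split_ifs <;> rfl

/-- With the free group as structure group, `k` the generators and `k p₀ = 1`, the monodromy of the
image of a word `w` is right multiplication by `w⁻¹`, so it moves 1 unless `w = 1`. -/
theorem lift_loopClass_injective (p₀ : S) :
    Function.Injective (FreeGroup.lift fun p : Punctured p₀ => loopClass p₀ p.1) := by
  classical
  let _ : TopologicalSpace (FreeGroup (Punctured p₀)) := ⊥
  have : DiscreteTopology (FreeGroup (Punctured p₀)) := ⟨rfl⟩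
  let k : S → FreeGroup (Punctured p₀) := fun p =>
    if h : p ≠ p₀ then FreeGroup.of ⟨p, h⟩ else 1
  let ρ := ((isCoveringMap_bundle p₀ k).monodromyPerm (verticalRay p₀)).comp
    (FreeGroup.lift fun p : Punctured p₀ => loopClass p₀ p.1)
  have hof : ∀ p g, ρ (FreeGroup.of p) (fibrePoint p₀ k g) =
      fibrePoint p₀ k (g * (FreeGroup.of p)⁻¹) := by
    intro p g
    have := monodromy_loopClass p₀ k p.1 g
    simpa [ρ, k, p.2] using this
  have key : ∀ w g, ρ w (fibrePoint p₀ k g) = fibrePoint p₀ k (g * w⁻¹) := by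
    intro w
    induction w using FreeGroup.induction_on with
    | C1 => simp
    | of p => exact hof p
    | inv_of p _ =>
      intro g
      rw [map_inv, Equiv.Perm.inv_eq_iff_eq, hof, inv_inv, mul_inv_cancel_right]
    | mul a b ha hb =>
      intro g
      rw [map_mul, Equiv.Perm.mul_apply, hb, ha, mul_inv_rev, mul_assoc]
  refine (injective_iff_map_eq_one _).2 fun w hw => ?_
  have hρ : ρ w = 1 := by
    change (isCoveringMap_bundle p₀ k).monodromyPerm (verticalRay p₀) (FreeGroup.lift _ w) = 1
    rw [hw, map_one]
  have := key w 1
  rw [hρ, Equiv.Perm.one_apply, one_mul] at this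
  exact inv_eq_one.1 (fibrePoint_injective p₀ k this).symm

end Coverings

/-! ### Splitting paths -/

section Paths

variable {X : Type*} [TopologicalSpace X] {a b : X}

/-- The restriction of a path to `[0, t]`. -/
def initialPath (γ : Path a b) (t : I) : Path a (γ t) := (γ.subpath 0 t).cast γ.source.symm rfl

theorem mk_initialPath_zero (γ : Path a b) :
    Path.Homotopic.Quotient.mk (initialPath γ 0) =
      (Path.Homotopic.Quotient.refl a).cast rfl γ.source := by
  rw [← Path.Homotopic.Quotient.mk_refl, ← Path.Homotopic.Quotient.mk_cast]
  congr 1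
  ext t
  simp [initialPath]

theorem mk_initialPath_one (γ : Path a b) :
    Path.Homotopic.Quotient.mk (initialPath γ 1) =
      (Path.Homotopic.Quotient.mk γ).cast rfl γ.target := by
  rw [← Path.Homotopic.Quotient.mk_cast]
  congr 1
  ext t
  simp [initialPath]

/-- No order between `s` and `t` is assumed, so admissibility can be propagated in both directions
along a path. -/
theorem mk_initialPath_trans (γ : Path a b) (s t : I) :
    (Path.Homotopic.Quotient.mk (initialPath γ s)).trans
      (Path.Homotopic.Quotient.mk (γ.subpath s t)) =
      Path.Homotopic.Quotient.mk (initialPath γ t) := by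
  have h : Path.Homotopic.Quotient.mk ((γ.subpath 0 s).trans (γ.subpath s t)) =
      Path.Homotopic.Quotient.mk (γ.subpath 0 t) :=
    Path.Homotopic.Quotient.eq.2 ⟨Path.Homotopy.subpathTransSubpath γ 0 s t⟩
  have h' := congrArg (fun q => q.cast γ.source.symm rfl) h
  simp only [← Path.Homotopic.Quotient.mk_cast] at h'
  rw [← Path.Homotopic.Quotient.mk_trans]
  refine Eq.trans (congrArg _ ?_) h'
  ext u
  simp only [Path.trans_apply, Path.cast_coe]
  rfl

theorem subpath_mem (γ : Path a b) {s t : I} {U : Set X} (h : ∀ u ∈ uIcc s t, γ u ∈ U) (u : I) :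
    γ.subpath s t u ∈ U := by
  obtain ⟨v, hv, hvu⟩ := (γ.range_subpath s t).subset (mem_range_self u)
  rw [← hvu]
  exact h v hv

end Paths

/-! ### Paths in chart domains -/

theorem isSimplyConnected_chartDomain (p : S) : IsSimplyConnected (chartDomain p) := by
  have h : IsSimplyConnected (univ : Set (Hyperplane n × ℝ)) :=
    (Homeomorph.Set.univ _).toHomotopyEquiv.simplyConnectedSpace
  rw [chartDomain, ← image_univ]
  exact (isOpenEmbedding_chart p).isEmbedding.isSimplyConnected_image.2 h

theorem isPathConnected_half (i : Bool) : IsPathConnected (half S i) :=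
  isPathConnected_range ((continuous_incl i).comp continuous_inner)

theorem exists_class_chartDomain {p : S} {x y : Manifold n S} (hx : x ∈ chartDomain p)
    (hy : y ∈ chartDomain p) : ∃ a : Path.Homotopic.Quotient x y,
      ∀ γ : Path x y, (∀ t, γ t ∈ chartDomain p) → Path.Homotopic.Quotient.mk γ = a := by
  have := (isSimplyConnected_chartDomain p).simplyConnectedSpace
  have lift : ∀ γ : Path x y, (∀ t, γ t ∈ chartDomain p) →
      ∃ δ : Path (⟨x, hx⟩ : chartDomain p) ⟨y, hy⟩, γ = δ.map continuous_subtype_val :=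
    fun γ h => ⟨⟨⟨fun t => ⟨γ t, h t⟩, by fun_prop⟩, Subtype.ext γ.source, Subtype.ext γ.target⟩, rfl⟩
  refine ⟨.mk ((PathConnectedSpace.somePath (⟨x, hx⟩ : chartDomain p) ⟨y, hy⟩).map
    continuous_subtype_val), fun γ h => ?_⟩
  obtain ⟨δ, rfl⟩ := lift γ h
  exact Path.Homotopic.Quotient.eq.2
    ((SimplyConnectedSpace.paths_homotopic δ _).map ⟨Subtype.val, continuous_subtype_val⟩)

/-- The unique homotopy class of paths between two points of a chart domain that contains paths in
that domain. -/
def transit (p : S) {x y : Manifold n S} (hx : x ∈ chartDomain p) (hy : y ∈ chartDomain p) :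
    Path.Homotopic.Quotient x y := (exists_class_chartDomain hx hy).choose

theorem mk_eq_transit {p : S} {x y : Manifold n S} (hx : x ∈ chartDomain p)
    (hy : y ∈ chartDomain p) (γ : Path x y) (h : ∀ t, γ t ∈ chartDomain p) :
    Path.Homotopic.Quotient.mk γ = transit p hx hy :=
  (exists_class_chartDomain hx hy).choose_spec γ h

theorem exists_path_transit {p : S} {x y : Manifold n S} (hx : x ∈ chartDomain p)
    (hy : y ∈ chartDomain p) : ∃ γ : Path x y, (∀ t, γ t ∈ chartDomain p) ∧
      Path.Homotopic.Quotient.mk γ = transit p hx hy := by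
  have h := (isSimplyConnected_chartDomain p).isPathConnected.joinedIn x hx y hy
  exact ⟨h.somePath, h.somePath_mem, mk_eq_transit hx hy _ h.somePath_mem⟩

theorem transit_self {p : S} {x : Manifold n S} (hx : x ∈ chartDomain p) :
    transit p hx hx = .refl x :=
  (mk_eq_transit hx hx (Path.refl x) fun _ => hx).symm

theorem transit_trans {p : S} {x y z : Manifold n S} (hx : x ∈ chartDomain p)
    (hy : y ∈ chartDomain p) (hz : z ∈ chartDomain p) :
    (transit p hx hy).trans (transit p hy hz) = transit p hx hz := by
  obtain ⟨γ, h, hγ⟩ := exists_path_transit hx hy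
  obtain ⟨δ, h', hδ⟩ := exists_path_transit hy hz
  rw [← hγ, ← hδ, ← Path.Homotopic.Quotient.mk_trans]
  refine mk_eq_transit hx hz _ fun t => ?_
  have : γ.trans δ t ∈ range (γ.trans δ) := mem_range_self t
  rw [Path.trans_range] at this
  rcases this with ⟨u, hu⟩ | ⟨u, hu⟩
  · exact hu ▸ h u
  · exact hu ▸ h' u

theorem transit_trans_assoc {p : S} {x y z w : Manifold n S} (hx : x ∈ chartDomain p)
    (hy : y ∈ chartDomain p) (hz : z ∈ chartDomain p) (a : Path.Homotopic.Quotient z w) :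
    (transit p hx hy).trans ((transit p hy hz).trans a) = (transit p hx hz).trans a := by
  rw [← Path.Homotopic.Quotient.trans_assoc, transit_trans]

/-- A path inside the half-space lies in both chart domains. Between different half-spaces no such
path exists, and the dependence on the chart there is what the loop classes measure. -/
theorem transit_congr (p q : S) {i : Bool} {x y : Manifold n S} (hx : x ∈ half S i)
    (hy : y ∈ half S i) :
    transit p (half_subset_chartDomain i p hx) (half_subset_chartDomain i p hy) =
      transit q (half_subset_chartDomain i q hx) (half_subset_chartDomain i q hy) := by
  have h := (isPathConnected_half i).joinedIn x hx y hy
  rw [← mk_eq_transit _ _ h.somePath fun t => half_subset_chartDomain i p (h.somePath_mem t),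
    ← mk_eq_transit _ _ h.somePath fun t => half_subset_chartDomain i q (h.somePath_mem t)]

/-! ### The loops generate the fundamental group -/

theorem verticalRay_mem (p : S) : verticalRay p ∈ chartDomain p := ray_mem_chartDomain.2 rfl

theorem incl_arc_mem_source (i : Bool) {p q : S} {s : I} (h : s < 1) :
    incl i (arc p q s) ∈ chartDomain p := by
  change incl i (arcFun p q s) ∈ _
  rw [arcFun]
  split_ifs with h1 h2
  · exact inner_mem_chartDomain p i _
  · exact ray_mem_chartDomain.2 rfl
  -- Zero height strictly inside the arc means that `p = q` and the arc is constant.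
  · refine ray_mem_chartDomain.2 ?_
    by_contra hpq
    exact h1 (arcHeight_pos (fun e => hpq (Subtype.ext e.symm)) (unitInterval.pos_iff_ne_zero.2 h2) h)

theorem incl_arc_mem_target (i : Bool) {p q : S} {s : I} (h : 0 < s) :
    incl i (arc p q s) ∈ chartDomain q := by
  change incl i (arcFun p q s) ∈ _
  rw [arcFun]
  split_ifs with h1 h2
  · exact inner_mem_chartDomain q i _
  · exact absurd h2 h.ne'
  · exact ray_mem_chartDomain.2 rfl

theorem incl_arc_mem_half (i : Bool) {p q : S} (hpq : p ≠ q) {s : I} (h0 : 0 < s) (h1 : s < 1) :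
    incl i (arc p q s) ∈ half S i := by
  have h : 0 < arcHeight p.1 q.1 s := arcHeight_pos (fun e => hpq (Subtype.ext e)) h0 h1
  change incl i (arcFun p q s) ∈ _
  rw [arcFun, dif_pos h]
  exact ⟨_, rfl⟩

theorem loop_apply (p q : S) (t : I) : ∃ s : I,
    ((t : ℝ) ≤ 1 / 2 ∧ (s : ℝ) = 2 * t ∧ loop p q t = incl true (arc p q s)) ∨
      (1 / 2 < (t : ℝ) ∧ (s : ℝ) = 2 - 2 * t ∧ loop p q t = incl false (arc p q s)) := by
  have h : loop p q t = _ := Path.trans_apply _ _ _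
  split_ifs at h with ht
  · exact ⟨_, Or.inl ⟨ht, rfl, h⟩⟩
  · refine ⟨_, Or.inr ⟨not_le.1 ht, ?_, h⟩⟩
    simp only [unitInterval.coe_symm_eq]
    ring

theorem loop_mem_source (p q : S) {t : I} (h : (t : ℝ) ≠ 1 / 2) : loop p q t ∈ chartDomain p := by
  obtain ⟨s, ⟨ht, hs, e⟩ | ⟨ht, hs, e⟩⟩ := loop_apply p q t
  · have : (t : ℝ) < 1 / 2 := lt_of_le_of_ne ht h
    exact e ▸ incl_arc_mem_source true (show (s : ℝ) < 1 by linarith)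
  · exact e ▸ incl_arc_mem_source false (show (s : ℝ) < 1 by linarith)

theorem loop_mem_target (p q : S) {t : I} (h0 : 0 < (t : ℝ)) (h1 : (t : ℝ) < 1) :
    loop p q t ∈ chartDomain q := by
  obtain ⟨s, ⟨ht, hs, e⟩ | ⟨ht, hs, e⟩⟩ := loop_apply p q t
  · exact e ▸ incl_arc_mem_target true (show 0 < (s : ℝ) by linarith)
  · exact e ▸ incl_arc_mem_target false (show 0 < (s : ℝ) by linarith)

theorem loop_mem_half_true {p q : S} (hpq : p ≠ q) {t : I} (h0 : 0 < (t : ℝ))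
    (h1 : (t : ℝ) < 1 / 2) : loop p q t ∈ half S true := by
  obtain ⟨s, ⟨ht, hs, e⟩ | ⟨ht, hs, e⟩⟩ := loop_apply p q t
  · exact e ▸ incl_arc_mem_half true hpq (show 0 < (s : ℝ) by linarith)
      (show (s : ℝ) < 1 by linarith)
  · linarith

theorem loop_mem_half_false {p q : S} (hpq : p ≠ q) {t : I} (h0 : 1 / 2 < (t : ℝ))
    (h1 : (t : ℝ) < 1) : loop p q t ∈ half S false := by
  obtain ⟨s, ⟨ht, hs, e⟩ | ⟨ht, hs, e⟩⟩ := loop_apply p q t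
  · linarith
  · exact e ▸ incl_arc_mem_half false hpq (show 0 < (s : ℝ) by linarith)
      (show (s : ℝ) < 1 by linarith)

/-- A reference point in the open half-space in the copy with index `i`. -/
def pole (S : Set (Hyperplane n)) (i : Bool) : Manifold n S := incl i (.inner ⟨(0, 1), one_pos⟩)

theorem pole_mem_half (i : Bool) : pole S i ∈ half S i := ⟨_, rfl⟩

theorem pole_mem (p : S) (i : Bool) : pole S i ∈ chartDomain p := inner_mem_chartDomain p i _

/-- Cut at 1/4 and 3/4: the outer pieces avoid the ray at `p` and stay in the chart at `p₀`, the
middle piece stays in the chart at `p`. For `p ≠ p₀` the cut points lie in the half-spaces and can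
be slid to the poles; for `p = p₀` everything takes place in one chart. -/
theorem loopClass_eq (p₀ p : S) : loopClass p₀ p =
    (transit p₀ (verticalRay_mem p₀) (pole_mem p₀ true)).trans
      ((transit p (pole_mem p true) (pole_mem p false)).trans
        (transit p₀ (pole_mem p₀ false) (verticalRay_mem p₀))) := by
  let s : I := ⟨1 / 4, by norm_num, by norm_num⟩
  let t : I := ⟨3 / 4, by norm_num, by norm_num⟩
  have hs : (s : ℝ) = 1 / 4 := rfl
  have ht : (t : ℝ) = 3 / 4 := rfl
  have hst : s ≤ t := by
    rw [← Subtype.coe_le_coe, hs, ht]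
    norm_num
  set γ := loop p₀ p with hγ
  have hs₀ : γ s ∈ chartDomain p₀ := loop_mem_source p₀ p (by rw [hs]; norm_num)
  have ht₀ : γ t ∈ chartDomain p₀ := loop_mem_source p₀ p (by rw [ht]; norm_num)
  have hs₁ : γ s ∈ chartDomain p :=
    loop_mem_target p₀ p (by rw [hs]; norm_num) (by rw [hs]; norm_num)
  have ht₁ : γ t ∈ chartDomain p :=
    loop_mem_target p₀ p (by rw [ht]; norm_num) (by rw [ht]; norm_num)
  have e : loopClass p₀ p = (transit p₀ (verticalRay_mem p₀) hs₀).trans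
      ((transit p hs₁ ht₁).trans (transit p₀ ht₀ (verticalRay_mem p₀))) := by
    have h₁ : Path.Homotopic.Quotient.mk (initialPath γ s) = transit p₀ (verticalRay_mem p₀) hs₀ := by
      refine mk_eq_transit _ _ _ (subpath_mem γ fun u hu => loop_mem_source p₀ p ?_)
      rw [uIcc_of_le unitInterval.nonneg'] at hu
      have : (u : ℝ) ≤ 1 / 4 := hu.2
      linarith
    have h₂ : Path.Homotopic.Quotient.mk (γ.subpath s t) = transit p hs₁ ht₁ := by
      refine mk_eq_transit _ _ _ (subpath_mem γ fun u hu => ?_)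
      rw [uIcc_of_le hst] at hu
      have h1 : 1 / 4 ≤ (u : ℝ) := hu.1
      have h2 : (u : ℝ) ≤ 3 / 4 := hu.2
      exact loop_mem_target p₀ p (by linarith) (by linarith)
    have h₃ : Path.Homotopic.Quotient.mk ((γ.subpath t 1).cast rfl γ.target.symm) =
        transit p₀ ht₀ (verticalRay_mem p₀) := by
      refine mk_eq_transit _ _ _ (subpath_mem γ fun u hu => loop_mem_source p₀ p ?_)
      rw [uIcc_of_le unitInterval.le_one'] at hu
      have : 3 / 4 ≤ (u : ℝ) := hu.1
      linarith
    rw [← h₁, ← h₂, ← h₃, ← Path.Homotopic.Quotient.trans_assoc, mk_initialPath_trans]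
    have := congrArg (fun q => q.cast rfl γ.target.symm) (mk_initialPath_trans γ t 1)
    rw [mk_initialPath_one] at this
    simp only [Path.Homotopic.Quotient.cast_cast, Path.Homotopic.Quotient.cast_rfl_rfl] at this
    refine Eq.trans this.symm ?_
    rw [← Path.Homotopic.Quotient.mk_trans, ← Path.Homotopic.Quotient.mk_trans,
      ← Path.Homotopic.Quotient.mk_cast]
    congr 1
  rw [e]
  rcases eq_or_ne p₀ p with rfl | hp
  · simp only [transit_trans]
  · have hs₂ : γ s ∈ half S true :=
      loop_mem_half_true hp (by rw [hs]; norm_num) (by rw [hs]; norm_num)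
    have ht₂ : γ t ∈ half S false :=
      loop_mem_half_false hp (by rw [ht]; norm_num) (by rw [ht]; norm_num)
    rw [← transit_trans (verticalRay_mem p₀) (pole_mem p₀ true) hs₀,
      ← transit_trans ht₀ (pole_mem p₀ false) (verticalRay_mem p₀),
      transit_congr p₀ p (pole_mem_half true) hs₂, transit_congr p₀ p ht₂ (pole_mem_half false)]
    simp only [Path.Homotopic.Quotient.trans_assoc, transit_trans_assoc]

theorem loopClass_self (p₀ : S) : loopClass p₀ p₀ = 1 := by
  rw [loopClass_eq]
  simp only [transit_trans]
  exact transit_self _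

/-- A homotopy class of paths starting at the base point is admissible if, after returning from its
end point to the base point through any chart domain and the first half-space, it represents
an element of the given subgroup. -/
def Admissible {p₀ : S} (H : Subgroup (FundamentalGroup (Manifold n S) (verticalRay p₀)))
    {x : Manifold n S} (a : Path.Homotopic.Quotient (verticalRay p₀) x) : Prop :=
  ∀ (p : S) (hx : x ∈ chartDomain p), FundamentalGroup.fromPath (a.trans
    ((transit p hx (pole_mem p true)).trans (transit p₀ (pole_mem p₀ true) (verticalRay_mem p₀)))) ∈ H

variable {p₀ : S} {H : Subgroup (FundamentalGroup (Manifold n S) (verticalRay p₀))}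

/-- One return chart suffices. The choice only matters over the second half-space; there, returning
through chart `r` and then following the loop at `r` amounts to returning through the second pole
and the chart at `p₀`, independently of `r`. As loop classes lie in `H`, membership does not depend
on `r`. -/
theorem admissible_of_mem (hH : ∀ p, loopClass p₀ p ∈ H) {x : Manifold n S}
    (a : Path.Homotopic.Quotient (verticalRay p₀) x) {p : S} (hp : x ∈ chartDomain p)
    (h : FundamentalGroup.fromPath (a.trans ((transit p hp (pole_mem p true)).trans
      (transit p₀ (pole_mem p₀ true) (verticalRay_mem p₀)))) ∈ H) : Admissible H a := by
  intro q hq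
  rcases eq_or_mem_half hp hq with rfl | ⟨_ | _, hi⟩
  · exact h
  · have key : ∀ r : S, (a.trans ((transit r (half_subset_chartDomain _ r hi) (pole_mem r true)).trans
        (transit p₀ (pole_mem p₀ true) (verticalRay_mem p₀)))).trans (loopClass p₀ r) =
        a.trans ((transit r (half_subset_chartDomain _ r hi) (pole_mem r false)).trans
          (transit p₀ (pole_mem p₀ false) (verticalRay_mem p₀))) := fun r => by
      rw [loopClass_eq]
      simp only [Path.Homotopic.Quotient.trans_assoc, transit_trans_assoc, transit_self,
        Path.Homotopic.Quotient.refl_trans]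
    have e := (key q).trans (Eq.trans (by rw [transit_congr q p hi (pole_mem_half false)]) (key p).symm)
    have hm : loopClass p₀ q * FundamentalGroup.fromPath (a.trans
        ((transit q hq (pole_mem q true)).trans
          (transit p₀ (pole_mem p₀ true) (verticalRay_mem p₀)))) ∈ H := by
      rw [FundamentalGroup.mul_def, e, ← FundamentalGroup.mul_def]
      exact H.mul_mem (hH p) h
    exact (H.mul_mem_cancel_left (hH q)).1 hm
  · rwa [transit_congr q p hi (pole_mem_half true)]

theorem Admissible.trans (hH : ∀ p, loopClass p₀ p ∈ H) {x y : Manifold n S}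
    {a : Path.Homotopic.Quotient (verticalRay p₀) x} (ha : Admissible H a) {p : S} (γ : Path x y)
    (hγ : ∀ t, γ t ∈ chartDomain p) :
    Admissible H (a.trans (Path.Homotopic.Quotient.mk γ)) := by
  have hx : x ∈ chartDomain p := γ.source ▸ hγ 0
  have hy : y ∈ chartDomain p := γ.target ▸ hγ 1
  refine admissible_of_mem hH _ hy ?_
  rw [mk_eq_transit hx hy γ hγ, Path.Homotopic.Quotient.trans_assoc, transit_trans_assoc]
  exact ha p hx

/-- Connectedness of the interval replaces a subdivision of the path: near each parameter the path
stays in one chart domain, where admissibility passes between any two parameters, so the admissible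
parameters form a clopen set. -/
theorem admissible_initialPath (hH : ∀ p, loopClass p₀ p ∈ H) {x : Manifold n S}
    (γ : Path (verticalRay p₀) x) (t : I) :
    Admissible H (Path.Homotopic.Quotient.mk (initialPath γ t)) := by
  set A : Set I := {t | Admissible H (Path.Homotopic.Quotient.mk (initialPath γ t))} with hA
  have key : ∀ t₀ : I, ∃ N ∈ 𝓝 t₀, ∀ s ∈ N, ∀ t ∈ N, s ∈ A → t ∈ A := by
    intro t₀
    have hn := γ.continuous.continuousAt.preimage_mem_nhds
      ((isOpen_chartDomain _).mem_nhds (mem_chartDomain_foot p₀ (γ t₀)))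
    obtain ⟨c, d, -, hcd, hsub⟩ := exists_Icc_mem_subset_of_mem_nhds hn
    refine ⟨Icc c d, hcd, fun s hs t ht hsA => ?_⟩
    have := Admissible.trans hH hsA (γ.subpath s t)
      (subpath_mem γ fun u hu => hsub (uIcc_subset_Icc hs ht hu))
    rwa [mk_initialPath_trans] at this
  have hclopen : IsClopen A := by
    refine ⟨isOpen_compl_iff.1 (isOpen_iff_mem_nhds.2 fun t₀ h₀ => ?_),
      isOpen_iff_mem_nhds.2 fun t₀ h₀ => ?_⟩ <;> obtain ⟨N, hN, hk⟩ := key t₀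
    · exact mem_of_superset hN fun t ht h => h₀ (hk t ht t₀ (mem_of_mem_nhds hN) h)
    · exact mem_of_superset hN fun t ht => hk t₀ (mem_of_mem_nhds hN) t ht h₀
  have h0 : (0 : I) ∈ A := by
    have cast_mem : ∀ (y : Manifold n S) (e : y = verticalRay p₀),
        Admissible H ((Path.Homotopic.Quotient.refl (verticalRay p₀)).cast rfl e) := by
      rintro _ rfl
      refine admissible_of_mem hH _ (verticalRay_mem p₀) ?_
      rw [transit_trans, transit_self, Path.Homotopic.Quotient.cast_rfl_rfl,
        Path.Homotopic.Quotient.refl_trans]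
      exact H.one_mem
    rw [hA, mem_ofPred_eq, mk_initialPath_zero]
    exact cast_mem _ γ.source
  rw [hclopen.eq_univ ⟨0, h0⟩] at hA
  exact hA.subset (mem_univ t)

/-- For a closed path the return route through the chart at `p₀` is trivial, so admissibility of the
whole path is membership of its class in `H`. -/
theorem eq_top_of_loopClass_mem (hH : ∀ p, loopClass p₀ p ∈ H) : H = ⊤ := by
  refine eq_top_iff.2 fun g _ => ?_
  obtain ⟨γ, rfl⟩ := Path.Homotopic.Quotient.mk_surjective g
  have h := admissible_initialPath hH γ 1
  rw [mk_initialPath_one] at h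
  have cast_mem : ∀ (y : Manifold n S) (e : y = verticalRay p₀),
      Admissible H ((Path.Homotopic.Quotient.mk γ).cast rfl e) →
      Admissible H (Path.Homotopic.Quotient.mk γ) := by
    rintro _ rfl h
    exact h
  have := cast_mem _ γ.target h p₀ (verticalRay_mem p₀)
  rwa [transit_trans, transit_self, Path.Homotopic.Quotient.trans_refl] at this

theorem lift_loopClass_surjective (p₀ : S) :
    Function.Surjective (FreeGroup.lift fun p : Punctured p₀ => loopClass p₀ p.1) := by
  refine MonoidHom.range_eq_top.1 (eq_top_of_loopClass_mem fun p => ?_)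
  rcases eq_or_ne p p₀ with rfl | hp
  · rw [loopClass_self]
    exact one_mem _
  · exact ⟨FreeGroup.of ⟨p, hp⟩, FreeGroup.lift_apply_of⟩

theorem evalOnLoops_bijective (p₀ : S) : Function.Bijective (evalOnLoops p₀) := by
  let e := MulEquiv.ofBijective (FreeGroup.lift fun p : Punctured p₀ => loopClass p₀ p.1)
    ⟨lift_loopClass_injective p₀, lift_loopClass_surjective p₀⟩
  have he : ∀ p : Punctured p₀, e (FreeGroup.of p) = loopClass p₀ p.1 := fun p =>
    FreeGroup.lift_apply_of (f := fun p : Punctured p₀ => loopClass p₀ p.1)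
  constructor
  · intro φ ψ h
    have : φ.toMul.comp e.toMonoidHom = ψ.toMul.comp e.toMonoidHom := by
      ext p
      have := congrFun h p
      change φ.toMul (e (FreeGroup.of p)) = ψ.toMul (e (FreeGroup.of p))
      rw [he]
      exact this
    refine congrArg Additive.ofMul (MonoidHom.ext fun g => ?_ : φ.toMul = ψ.toMul)
    obtain ⟨w, rfl⟩ := e.surjective g
    exact DFunLike.congr_fun this w
  · intro k
    refine ⟨Additive.ofMul ((FreeGroup.lift fun p => Multiplicative.ofAdd (k p)).comp
      e.symm.toMonoidHom), funext fun p => ?_⟩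
    change (FreeGroup.lift (fun p => Multiplicative.ofAdd (k p))
      (e.symm (loopClass p₀ p.1))).toAdd = k p
    rw [← he, e.symm_apply_apply, FreeGroup.lift_apply_of]
    rfl

end Prufer

end

theorem mainTheorem1 (n : ℕ) (hn : 2 ≤ n) (S : Set (Prufer.Hyperplane n)) (p₀ : S) :
    Function.Bijective
      (FreeGroup.lift fun p : Prufer.Punctured p₀ => Prufer.loopClass p₀ p.1) ∧
    Function.Bijective (Prufer.evalOnLoops p₀) ∧
    Function.Injective
      (Prufer.comparison (Prufer.Manifold n S) (Prufer.verticalRay p₀)) ∧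
    ((Prufer.evalOnLoops p₀).comp
        (Prufer.comparison (Prufer.Manifold n S) (Prufer.verticalRay p₀)).toAdditive).range =
      Prufer.baireOneSubgroup (Prufer.Punctured p₀) :=
  ⟨⟨Prufer.lift_loopClass_injective p₀, Prufer.lift_loopClass_surjective p₀⟩,
    Prufer.evalOnLoops_bijective p₀, Prufer.comparison_injective p₀, Prufer.range_comparison p₀⟩
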